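/- Let $(X,\mathcal B,\mu)$ be a standard Borel space with a non-atomic probability measure, and let $\mathrm{Aut}$ be the group of its invertible measure-preserving transformations, where transformations that agree almost everywhere are identified. Let $\{A_i\}_{i\ge 0}$ be a sequence of measurable sets that is dense in $\mathcal B$ for the distance $\mu(A\,\Delta\,B)$, and equip $\mathrm{Aut}$ with the Halmos metric $$\rho(S,T)=\sum_{i\ge 0} 2^{-i-1}\bigl(\mu(SA_i\,\Delta\, TA_i)+\mu(S^{-1}A_i\,\Delta\, T^{-1}A_i)\bigr).$$ A property of transformations is called generic if the set of $T\in\mathrm{Aut}$ that have it contains a dense $G_\delta$ subset of $(\mathrm{Aut},\rho)$. A geometric figure in $\mathbb R^d$ is a bounded set $F\subset\mathbb R^d$ whose boundary has upper box dimension less than $d$, i.e. there are $C$ and $s>0$ such that the $r$-neighbourhood of $\partial F$ has volume at most $Cr^s$ for all $0<r\le 1$ (for example a polytope, a convex body, or a bounded domain with piecewise smooth boundary). An isometric exchange of a finite collection of sets $F_1,\dots,F_n\subset\mathbb R^d$ is given by isometries $g_1,\dots,g_n$ of $\mathbb R^d$ such that, up to null sets, the $F_i$ are pairwise disjoint, the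 $g_i(F_i)$ are pairwise disjoint, and $\bigcup_i g_i(F_i)=\bigcup_i F_i=:Y$, where $Y$ has positive volume; it is the transformation of $Y$, with normalized Lebesgue measure, that equals $g_i$ on $F_i$. It is a rectangle exchange if every $F_i$ is a non-degenerate $d$-dimensional rectangular box, in any position and with any part of its boundary included. Then the following property of $T\in\mathrm{Aut}$ is generic: for every $d$, $T$ is not isomorphic (modulo null sets) to any isometric exchange of a finite collection of geometric figures in $\mathbb R^d$. In particular, it is a generic property of $T$ that, for every $d$, $T$ is not isomorphic to any rectangle exchange in $\mathbb R^d$. -/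

import Mathlib

open MeasureTheory Set Filter
open scoped symmDiff

noncomputable section

namespace GenericExchange

/-! ### The group of automorphisms of a probability space, with the Halmos metric -/

section Automorphisms

variable {X : Type*} [MeasurableSpace X]

/-- An invertible measure-preserving transformation of `(X, μ)`. -/
def MPEquiv (μ : Measure X) : Type _ := {T : X ≃ᵐ X // MeasurePreserving T μ μ}

/-- Transformations that agree almost everywhere are identified. -/
instance aeSetoid (μ : Measure X) : Setoid (MPEquiv μ) where
  r S T := ∀ᵐ x ∂μ, S.1 x = T.1 x
  iseqv :=
    { refl := fun _ => Eventually.of_forall fun _ => rfl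
      symm := fun h => h.mono fun _ hx => hx.symm
      trans := fun h k => by
        filter_upwards [h, k] with x hx kx
        exact hx.trans kx }

/-- The automorphisms of `(X, μ)`: invertible measure-preserving transformations modulo
almost everywhere equality. -/
def Aut (μ : Measure X) : Type _ := Quotient (aeSetoid μ)

/-- A sequence of measurable sets that is dense in the measure algebra of `μ`. -/
def IsDenseFamily (μ : Measure X) (A : ℕ → Set X) : Prop :=
  (∀ i, MeasurableSet (A i)) ∧
    ∀ B : Set X, MeasurableSet B → ∀ ε : ℝ, 0 < ε → ∃ i, μ.real (A i ∆ B) < ε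

/-- The `i`-th term of the Halmos metric, `μ(SAᵢ ∆ TAᵢ) + μ(S⁻¹Aᵢ ∆ T⁻¹Aᵢ)`. -/
def halmosTerm (μ : Measure X) (A : ℕ → Set X) (S T : MPEquiv μ) (i : ℕ) : ℝ :=
  μ.real ((S.1 '' A i) ∆ (T.1 '' A i)) + μ.real ((S.1 ⁻¹' A i) ∆ (T.1 ⁻¹' A i))

/-- The Halmos metric on representatives; the weights `2⁻ⁱ⁻¹` make the series converge. -/
def preHalmosDist (μ : Measure X) (A : ℕ → Set X) (S T : MPEquiv μ) : ℝ :=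
  ∑' i, (1 / 2 : ℝ) ^ (i + 1) * halmosTerm μ A S T i

theorem preimage_ae_eq {μ : Measure X} {S S' : MPEquiv μ} (h : S ≈ S') (B : Set X) :
    S.1 ⁻¹' B =ᵐ[μ] S'.1 ⁻¹' B := by
  have h' : ∀ᵐ x ∂μ, S.1 x = S'.1 x := h
  filter_upwards [h'] with x hx
  change (S.1 x ∈ B) = (S'.1 x ∈ B)
  rw [hx]

theorem image_ae_eq {μ : Measure X} {S S' : MPEquiv μ} (h : S ≈ S') (B : Set X) :
    S.1 '' B =ᵐ[μ] S'.1 '' B := by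
  have h' : ∀ᵐ x ∂μ, S.1 x = S'.1 x := h
  have hs : ∀ᵐ y ∂μ, S.1 (S.1.symm y) = S'.1 (S.1.symm y) :=
    (S.2.symm S.1).quasiMeasurePreserving.ae h'
  rw [S.1.image_eq_preimage_symm, S'.1.image_eq_preimage_symm]
  filter_upwards [hs] with y hy
  change (S.1.symm y ∈ B) = (S'.1.symm y ∈ B)
  have hy' : S'.1.symm y = S.1.symm y := by
    rw [S.1.apply_symm_apply] at hy
    rw [MeasurableEquiv.symm_apply_eq]
    exact hy
  rw [hy']

theorem preHalmosDist_congr {μ : Measure X} (A : ℕ → Set X) (S T S' T' : MPEquiv μ)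
    (hS : S ≈ S') (hT : T ≈ T') : preHalmosDist μ A S T = preHalmosDist μ A S' T' := by
  refine tsum_congr fun i => ?_
  have h1 := measureReal_congr ((image_ae_eq hS (A i)).symmDiff (image_ae_eq hT (A i)))
  have h2 := measureReal_congr ((preimage_ae_eq hS (A i)).symmDiff (preimage_ae_eq hT (A i)))
  simp only [halmosTerm, h1, h2]

/-- The Halmos metric `ρ(S, T) = ∑ 2⁻ⁱ⁻¹ (μ(SAᵢ ∆ TAᵢ) + μ(S⁻¹Aᵢ ∆ T⁻¹Aᵢ))`. -/
def halmosDist (μ : Measure X) (A : ℕ → Set X) (S T : Aut μ) : ℝ :=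
  Quotient.lift₂ (preHalmosDist μ A) (preHalmosDist_congr A) S T

theorem summable_halmos (μ : Measure X) [IsProbabilityMeasure μ] (A : ℕ → Set X)
    (S T : MPEquiv μ) :
    Summable fun i => (1 / 2 : ℝ) ^ (i + 1) * halmosTerm μ A S T i := by
  have hg : Summable fun i : ℕ => (1 / 2 : ℝ) ^ i := summable_geometric_two
  refine Summable.of_nonneg_of_le (fun i => ?_) (fun i => ?_) hg
  · exact mul_nonneg (by positivity) (add_nonneg measureReal_nonneg measureReal_nonneg)
  · have h : halmosTerm μ A S T i ≤ 1 + 1 := add_le_add measureReal_le_one measureReal_le_one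
    have hp : (0 : ℝ) ≤ (1 / 2 : ℝ) ^ (i + 1) := by positivity
    calc (1 / 2 : ℝ) ^ (i + 1) * halmosTerm μ A S T i ≤ (1 / 2 : ℝ) ^ (i + 1) * (1 + 1) :=
          mul_le_mul_of_nonneg_left h hp
      _ = (1 / 2 : ℝ) ^ i := by ring

/-- The space of automorphisms with the Halmos metric. (When the family `A` is dense, distance
zero means equality; only the induced topology is used below.) -/
@[reducible]
def halmosMetric (μ : Measure X) [IsProbabilityMeasure μ] (A : ℕ → Set X) :
    PseudoMetricSpace (Aut μ) where
  dist := halmosDist μ A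
  dist_self := by
    rintro ⟨S⟩
    change preHalmosDist μ A S S = 0
    simp [preHalmosDist, halmosTerm]
  dist_comm := by
    rintro ⟨S⟩ ⟨T⟩
    change preHalmosDist μ A S T = preHalmosDist μ A T S
    simp only [preHalmosDist, halmosTerm, symmDiff_comm]
  dist_triangle := by
    rintro ⟨S⟩ ⟨T⟩ ⟨R⟩
    change preHalmosDist μ A S R ≤ preHalmosDist μ A S T + preHalmosDist μ A T R
    unfold preHalmosDist
    rw [← (summable_halmos μ A S T).tsum_add (summable_halmos μ A T R)]
    refine (summable_halmos μ A S R).tsum_le_tsum (fun i => ?_)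
      ((summable_halmos μ A S T).add (summable_halmos μ A T R))
    rw [← mul_add]
    refine mul_le_mul_of_nonneg_left ?_ (by positivity)
    have h1 : μ.real ((S.1 '' A i) ∆ (R.1 '' A i)) ≤
        μ.real ((S.1 '' A i) ∆ (T.1 '' A i)) + μ.real ((T.1 '' A i) ∆ (R.1 '' A i)) :=
      (measureReal_mono (symmDiff_triangle _ _ _)).trans (measureReal_union_le _ _)
    have h2 : μ.real ((S.1 ⁻¹' A i) ∆ (R.1 ⁻¹' A i)) ≤
        μ.real ((S.1 ⁻¹' A i) ∆ (T.1 ⁻¹' A i)) + μ.real ((T.1 ⁻¹' A i) ∆ (R.1 ⁻¹' A i)) :=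
      (measureReal_mono (symmDiff_triangle _ _ _)).trans (measureReal_union_le _ _)
    unfold halmosTerm
    linarith

/-- A property of automorphisms is generic if the set of automorphisms that have it contains
a dense `G_δ` set with respect to the Halmos metric. -/
def IsGenericProperty (μ : Measure X) [IsProbabilityMeasure μ] (A : ℕ → Set X)
    (p : Aut μ → Prop) : Prop :=
  letI : PseudoMetricSpace (Aut μ) := halmosMetric μ A
  ∃ W : Set (Aut μ), IsGδ W ∧ Dense W ∧ ∀ T ∈ W, p T

end Automorphisms

/-! ### Isomorphism of measure-preserving systems -/

/-- `(X, μ, T)` and `(Y, ν, S)` are isomorphic (modulo null sets): `φ` and `ψ` are mutually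
inverse almost everywhere, preserve the measures, and `φ` intertwines `T` and `S`. -/
def IsIsomorphic {X Y : Type*} [MeasurableSpace X] [MeasurableSpace Y]
    (μ : Measure X) (T : X → X) (ν : Measure Y) (S : Y → Y) : Prop :=
  ∃ (φ : X → Y) (ψ : Y → X), MeasurePreserving φ μ ν ∧ MeasurePreserving ψ ν μ ∧
    (∀ᵐ x ∂μ, ψ (φ x) = x) ∧ (∀ᵐ y ∂ν, φ (ψ y) = y) ∧ ∀ᵐ x ∂μ, φ (T x) = S (φ x)

/-! ### Isometric exchanges -/

section Exchanges

/-- A geometric figure in `ℝᵈ`: a bounded set whose boundary has upper box (Minkowski) dimension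
less than `d`, that is, the volume of the `r`-neighbourhood of the boundary is `O(rˢ)`
for some `s > 0`. Polytopes, convex bodies and domains with piecewise smooth
boundary are of this kind. -/
def IsFigure {d : ℕ} (F : Set (EuclideanSpace ℝ (Fin d))) : Prop :=
  Bornology.IsBounded F ∧ ∃ C s : ℝ, 0 < s ∧ ∀ r : ℝ, 0 < r → r ≤ 1 →
    volume (Metric.thickening r (frontier F)) ≤ ENNReal.ofReal (C * r ^ s)

/-- A nondegenerate rectangle (rectangular parallelepiped) in `ℝᵈ` in arbitrary position,
with any part of its boundary included. -/
def IsRectangle {d : ℕ} (F : Set (EuclideanSpace ℝ (Fin d))) : Prop :=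
  ∃ (a b : Fin d → ℝ) (g : EuclideanSpace ℝ (Fin d) ≃ᵢ EuclideanSpace ℝ (Fin d)),
    (∀ k, a k < b k) ∧ g '' {x | ∀ k, a k < x k ∧ x k < b k} ⊆ F ∧
      F ⊆ g '' {x | ∀ k, a k ≤ x k ∧ x k ≤ b k}

/-- An exchange of finitely many subsets of `ℝᵈ` by isometries: the pieces overlap only in null
sets, their images under the isometries overlap only in null sets, and the images
fill up, modulo null sets, the same domain. -/
structure IsometricExchange (d : ℕ) where
  n : ℕ
  piece : Fin n → Set (EuclideanSpace ℝ (Fin d))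
  isom : Fin n → EuclideanSpace ℝ (Fin d) ≃ᵢ EuclideanSpace ℝ (Fin d)
  piece_disjoint : ∀ i j, i ≠ j → volume (piece i ∩ piece j) = 0
  image_disjoint : ∀ i j, i ≠ j → volume ((isom i '' piece i) ∩ (isom j '' piece j)) = 0
  union_image : (⋃ i, isom i '' piece i) =ᵐ[volume] ⋃ i, piece i
  volume_ne_zero : volume (⋃ i, piece i) ≠ 0

namespace IsometricExchange

variable {d : ℕ} (E : IsometricExchange d)

/-- The domain of the exchange. -/
def domain : Set (EuclideanSpace ℝ (Fin d)) := ⋃ i, E.piece i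

/-- Normalized Lebesgue measure on the domain. -/
def measure : Measure (EuclideanSpace ℝ (Fin d)) := ProbabilityTheory.cond volume E.domain

open Classical in
/-- The transformation that acts on each piece by the corresponding isometry. On the null set where
pieces overlap one of the isometries is chosen; outside the domain the value is irrelevant. -/
def map (x : EuclideanSpace ℝ (Fin d)) : EuclideanSpace ℝ (Fin d) :=
  if h : ∃ i, x ∈ E.piece i then E.isom h.choose x else x

/-- All the pieces are geometric figures. -/
def IsFigureExchange : Prop := ∀ i, IsFigure (E.piece i)

/-- All the pieces are rectangles. -/
def IsRectangleExchange : Prop := ∀ i, IsRectangle (E.piece i)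

end IsometricExchange

/-- The automorphism `T` is isomorphic to the exchange `E`. -/
def Aut.IsomorphicToExchange {X : Type*} [MeasurableSpace X] {μ : Measure X} (T : Aut μ)
    {d : ℕ} (E : IsometricExchange d) : Prop :=
  ∃ S : MPEquiv μ, (Quotient.mk (aeSetoid μ) S : Aut μ) = T ∧
    IsIsomorphic μ S.1 E.measure E.map

end Exchanges

end GenericExchange

end

/-!
Fix a set `B` of measure `1 / 2` and record the visits of an orbit to `B` as a binary word, up to a
small proportion of errors.

Let `T` be an automorphism. In a tower of height `L` over the Bernoulli scheme with alphabet `X`,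
in which `T` acts on all the coordinates and the coordinates are shifted every `L` steps, the
coordinate at the origin follows `T` except with probability `1 / L`, and its itinerary consists of
independent blocks of length `L`. By Hoeffding's inequality every word of length `n` is close to the
itineraries of a set of measure at most `exp (-n / (8 * L))`. As `X` is non-atomic, the tower can be
copied to `X` without disturbing finitely many given sets, so `T` is a limit of automorphisms for
which `2 ^ m` words are too few to describe the itineraries of length `m ^ 2` of half of the points,
for all large `m`. For a single `m` this is an open condition; hence generically it holds for
infinitely many `m`.

An exchange of figures acts as an isometry on each ball of radius `r` that avoids the boundaries of
the pieces. If `r` is a large negative power of `m`, then most orbits stay outside the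
`r`-neighbourhood of the boundaries, of volume `O(r ^ s)`, up to time `m ^ 2`. Such orbits starting
in the same cell of a fine grid remain at constant distance, and thus have nearly the same
itinerary; the number of cells is polynomial in `m`, so that `2 ^ m` words are enough for all
large `m`.
-/

noncomputable section

namespace GenericExchange

/-! ### Isomorphism of non-atomic standard probability spaces -/

section MeasureIsomorphism

open ProbabilityTheory

/-- The uniform distribution on the unit interval, as a measure on `ℝ`: the model to which
every non-atomic standard probability space is compared. -/
def uniformMeasure : Measure ℝ := volume.restrict (Icc 0 1)

instance : IsProbabilityMeasure uniformMeasure :=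
  ⟨by simp [uniformMeasure]⟩

instance : NullSingletonClass uniformMeasure := by
  unfold uniformMeasure; infer_instance

theorem uniformMeasure_Iic (t : ℝ) : uniformMeasure (Iic t) = ENNReal.ofReal (min t 1) := by
  have h : Iic t ∩ Icc 0 1 = Icc 0 (min t 1) := by
    ext x
    simp only [mem_inter_iff, mem_Iic, mem_Icc, le_min_iff]
    tauto
  rw [uniformMeasure, Measure.restrict_apply measurableSet_Iic, h, Real.volume_Icc, sub_zero]

theorem continuous_cdf (m : Measure ℝ) [IsProbabilityMeasure m] [NullSingletonClass m] :
    Continuous (cdf m) := by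
  refine continuous_iff_continuousAt.2 fun a => ?_
  have h : (cdf m).measure {a} = 0 := by rw [measure_cdf]; exact measure_singleton a
  rw [StieltjesFunction.measure_singleton, ENNReal.ofReal_eq_zero, sub_nonpos] at h
  rw [(monotone_cdf m).continuousAt_iff_leftLim_eq_rightLim, StieltjesFunction.rightLim_eq]
  exact le_antisymm ((monotone_cdf m).leftLim_le le_rfl) h

theorem measure_cdf_preimage_Iic (m : Measure ℝ) [IsProbabilityMeasure m] [NullSingletonClass m]
    {t : ℝ} (ht0 : 0 < t) (ht1 : t < 1) : m (cdf m ⁻¹' Iic t) = ENNReal.ofReal t := by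
  have hcont := continuous_cdf m
  obtain ⟨a, ha⟩ := ((tendsto_cdf_atBot m).eventually_lt_const ht0).exists
  obtain ⟨b, hb⟩ := ((tendsto_cdf_atTop m).eventually_const_lt ht1).exists
  obtain ⟨c, hc⟩ : t ∈ range (cdf m) :=
    mem_range_of_exists_le_of_exists_ge hcont ⟨a, ha.le⟩ ⟨b, hb.le⟩
  have hbdd : BddAbove (cdf m ⁻¹' Iic t) :=
    ⟨b, fun x hx => ((monotone_cdf m).reflect_lt (lt_of_le_of_lt hx hb)).le⟩
  have hmax : sSup (cdf m ⁻¹' Iic t) ∈ cdf m ⁻¹' Iic t :=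
    (isClosed_Iic.preimage hcont).csSup_mem ⟨c, hc.le⟩ hbdd
  have heq : cdf m ⁻¹' Iic t = Iic (sSup (cdf m ⁻¹' Iic t)) :=
    Subset.antisymm (fun x hx => le_csSup hbdd hx) fun x hx => (monotone_cdf m hx).trans hmax
  have hval : cdf m (sSup (cdf m ⁻¹' Iic t)) = t :=
    le_antisymm hmax (hc.ge.trans (monotone_cdf m (le_csSup hbdd hc.le)))
  rw [heq, ← ofReal_cdf, hval]

theorem map_cdf (m : Measure ℝ) [IsProbabilityMeasure m] [NullSingletonClass m] :
    m.map (cdf m) = uniformMeasure := by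
  have hmeas : Measurable (cdf m) := (monotone_cdf m).measurable
  have := Measure.isProbabilityMeasure_map (μ := m) hmeas.aemeasurable
  refine Measure.ext_of_Iic _ _ fun t => ?_
  rw [Measure.map_apply hmeas measurableSet_Iic, uniformMeasure_Iic]
  rcases le_or_gt t 0 with ht0 | ht0
  · have hlim : Tendsto ENNReal.ofReal (nhdsWithin 0 (Ioi 0)) (nhds 0) := by
      simpa using (ENNReal.continuous_ofReal.tendsto 0).mono_left nhdsWithin_le_nhds
    have hzero : m (cdf m ⁻¹' Iic t) ≤ 0 := by
      refine ge_of_tendsto hlim ?_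
      filter_upwards [Ioo_mem_nhdsGT zero_lt_one] with u hu
      rw [← measure_cdf_preimage_Iic m hu.1 hu.2]
      exact measure_mono (preimage_mono (Iic_subset_Iic.2 (ht0.trans hu.1.le)))
    rw [ENNReal.ofReal_of_nonpos ((min_le_left t 1).trans ht0)]
    exact le_antisymm hzero bot_le
  rcases lt_or_ge t 1 with ht1 | ht1
  · rw [min_eq_left ht1.le, measure_cdf_preimage_Iic m ht0 ht1]
  · have huniv : cdf m ⁻¹' Iic t = univ := eq_univ_of_forall fun x => (cdf_le_one m x).trans ht1
    rw [huniv, measure_univ, min_eq_right ht1, ENNReal.ofReal_one]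

theorem uncountable_of_nullSingletonClass {X : Type*} [MeasurableSpace X] (μ : Measure X)
    [NeZero μ] [NullSingletonClass μ] : Uncountable X := by
  refine not_countable_iff.1 fun _ => NeZero.ne μ ?_
  exact Measure.measure_univ_eq_zero.1 (countable_univ.measure_zero μ)

variable {X Y : Type*} [MeasurableSpace X] [StandardBorelSpace X]
  [MeasurableSpace Y] [StandardBorelSpace Y]

theorem exists_uncountable_null [Uncountable X] (μ : Measure X) [SFinite μ] :
    ∃ N : Set X, MeasurableSet N ∧ μ N = 0 ∧ ¬ N.Countable := by
  have hplane : ¬ Countable (ℝ × ℝ) := fun h =>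
    not_countable (α := ℝ) (Prod.mk_right_injective (0 : ℝ)).countable
  let e : X ≃ᵐ ℝ × ℝ := PolishSpace.measurableEquivOfNotCountable not_countable hplane
  let line : ℝ → Set X := fun a => (fun x => (e x).1) ⁻¹' {a}
  have hline : ∀ a, MeasurableSet (line a) := fun a =>
    (measurable_fst.comp e.measurable) (measurableSet_singleton a)
  have hcount : {a | 0 < μ (line a)}.Countable :=
    Measure.countable_meas_pos_of_disjoint_iUnion hline (pairwise_disjoint_fiber _)
  obtain ⟨a, ha⟩ : ∃ a, ¬ 0 < μ (line a) := by
    by_contra! h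
    exact not_countable_univ (hcount.mono fun x _ => h x)
  refine ⟨line a, hline a, by simpa using ha, fun h => ?_⟩
  have hinj : Function.Injective fun b : ℝ => e.symm (a, b) :=
    e.symm.injective.comp (Prod.mk_right_injective a)
  exact not_countable_univ ((h.preimage hinj).mono fun b _ => by simp [line])

theorem exists_measurableEquiv_eqOn {s : Set X} (hs : MeasurableSet s) (hsc : ¬ sᶜ.Countable)
    {h : X → Y} (hh : Measurable h) (hinj : InjOn h s) (hc : ¬ (h '' s)ᶜ.Countable) :
    ∃ e : X ≃ᵐ Y, EqOn e h s := by
  classical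
  have := hs.standardBorel
  have hemb : MeasurableEmbedding (s.domRestrict h) :=
    (hh.comp measurable_subtype_coe).measurableEmbedding (injOn_iff_injective.1 hinj)
  have ht : MeasurableSet (range (s.domRestrict h)) := hemb.measurableSet_range
  have := hs.compl.standardBorel
  have := ht.compl.standardBorel
  rw [← range_domRestrict h s] at hc
  let eCompl : ↥sᶜ ≃ᵐ ↥(range (s.domRestrict h))ᶜ :=
    PolishSpace.measurableEquivOfNotCountable hsc hc
  refine ⟨(MeasurableEquiv.sumCompl hs).symm.trans
    ((hemb.equivRange.sumCongr eCompl).trans (MeasurableEquiv.sumCompl ht)), fun x hx => ?_⟩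
  have hinl : (MeasurableEquiv.sumCompl hs).symm x = Sum.inl ⟨x, hx⟩ := by
    rw [MeasurableEquiv.symm_apply_eq]
    rfl
  simp only [MeasurableEquiv.trans_apply, hinl]
  change ((hemb.equivRange ⟨x, hx⟩ : range (s.domRestrict h)) : Y) = h x
  rw [hemb.equivRange_apply]
  rfl

/- Discarding an uncountable null set on each side leaves room to extend `h` from a conull set
to a bijection. -/
theorem exists_measurableEquiv_ae_eq [Uncountable X] [Uncountable Y] {μ : Measure X} [SFinite μ]
    {ν : Measure Y} [SFinite ν] {h : X → Y} (hh : Measure.QuasiMeasurePreserving h μ ν)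
    {s : Set X} (hs : MeasurableSet s) (hae : ∀ᵐ x ∂μ, x ∈ s) (hinj : InjOn h s) :
    ∃ e : X ≃ᵐ Y, e =ᵐ[μ] h := by
  obtain ⟨N, hN, hN0, hNc⟩ := exists_uncountable_null μ
  obtain ⟨M, hM, hM0, hMc⟩ := exists_uncountable_null ν
  let t : Set X := (s \ N) \ h ⁻¹' M
  have hN_subset : N ⊆ tᶜ := fun x hx hx' => hx'.1.2 hx
  have hM_subset : M ⊆ (h '' t)ᶜ := by
    rintro y hy ⟨x, hx, rfl⟩
    exact hx.2 hy
  obtain ⟨e, he⟩ := exists_measurableEquiv_eqOn ((hs.diff hN).diff (hh.measurable hM))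
    (fun hc => hNc (hc.mono hN_subset)) hh.measurable (hinj.mono fun x hx => hx.1.1)
    (fun hc => hMc (hc.mono hM_subset))
  refine ⟨e, ?_⟩
  filter_upwards [hae, measure_eq_zero_iff_ae_notMem.1 hN0,
    hh.ae (measure_eq_zero_iff_ae_notMem.1 hM0)] with x hxs hxN hxM
  exact he ⟨⟨hxs, hxN⟩, hxM⟩

theorem injOn_setOf_forall_rat_ne {F : ℝ → ℝ} (hF : Monotone F) :
    InjOn F {a | ∀ q : ℚ, F a ≠ F q} := by
  have hlt : ∀ a ∈ {a | ∀ q : ℚ, F a ≠ F q}, ∀ b, a < b → F a ≠ F b := by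
    intro a ha b hab h
    obtain ⟨q, haq, hqb⟩ := exists_rat_btwn hab
    exact ha q (le_antisymm (hF haq.le) (h ▸ hF hqb.le))
  intro a ha b hb h
  by_contra hab
  rcases lt_or_gt_of_ne hab with hab | hab
  · exact hlt a ha b hab h
  · exact hlt b hb a hab h.symm

theorem exists_measurableEquiv_uniform (μ : Measure X) [IsProbabilityMeasure μ]
    [NullSingletonClass μ] {g : X → ℝ} (hg : MeasurableEmbedding g) :
    ∃ e : X ≃ᵐ ℝ, MeasurePreserving e μ uniformMeasure ∧
      ∀ᵐ x ∂μ, e x = μ.real {y | g y ≤ g x} := by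
  have := Measure.isProbabilityMeasure_map (μ := μ) hg.measurable.aemeasurable
  have : NullSingletonClass (μ.map g) := ⟨fun a => by
    rw [hg.map_apply]
    exact (subsingleton_singleton.preimage hg.injective).measure_zero μ⟩
  have := uncountable_of_nullSingletonClass μ
  set F := cdf (μ.map g) with hF
  have hFm : Measurable F := (monotone_cdf _).measurable
  have hFg : MeasurePreserving (F ∘ g) μ uniformMeasure :=
    ⟨hFm.comp hg.measurable, by rw [← map_cdf (μ.map g), Measure.map_map hFm hg.measurable]⟩
  let s : Set X := {x | ∀ q : ℚ, F (g x) ≠ F q}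
  have hs : MeasurableSet s := by
    simp only [s, ofPred_forall]
    exact MeasurableSet.iInter fun q => hFg.measurable (measurableSet_singleton (F q)).compl
  have hs_ae : ∀ᵐ x ∂μ, x ∈ s := by
    filter_upwards [hFg.quasiMeasurePreserving.ae
      ((countable_range fun q : ℚ => F q).ae_notMem uniformMeasure)] with x hx q hq
    exact hx ⟨q, hq.symm⟩
  have hinj : InjOn (F ∘ g) s := fun x hx y hy h =>
    hg.injective (injOn_setOf_forall_rat_ne (monotone_cdf _) hx hy h)
  obtain ⟨e, he⟩ := exists_measurableEquiv_ae_eq hFg.quasiMeasurePreserving hs hs_ae hinj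
  refine ⟨e, ⟨e.measurable, by rw [Measure.map_congr he, hFg.map_eq]⟩, ?_⟩
  filter_upwards [he] with x hx
  rw [hx, Function.comp_apply, hF, cdf_eq_real,
    map_measureReal_apply hg.measurable measurableSet_Iic]
  rfl

theorem exists_measurableEmbedding_real_strictMono {f : X → ℕ} (hf : Measurable f) :
    ∃ g : X → ℝ, MeasurableEmbedding g ∧ ∀ x y, f x < f y → g x < g y := by
  let σ : X → ℝ := fun x => Real.sigmoid (embeddingReal X x)
  have hσ : ∀ x, σ x ∈ Ioo 0 1 := fun x => ⟨Real.sigmoid_pos _, Real.sigmoid_lt_one _⟩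
  have hσm : Measurable σ :=
    Real.sigmoid_strictMono.monotone.measurable.comp (measurable_embeddingReal X)
  have hσi : Function.Injective σ :=
    Real.sigmoid_injective.comp (measurableEmbedding_embeddingReal X).injective
  have hlt : ∀ x y, f x < f y → (f x : ℝ) + σ x < f y + σ y := by
    intro x y h
    have : (f x : ℝ) + 1 ≤ f y := by exact_mod_cast h
    linarith [(hσ x).2, (hσ y).1]
  refine ⟨fun x => f x + σ x, Measurable.measurableEmbedding
    ((measurable_from_top.comp hf).add hσm) fun x y h => ?_, hlt⟩
  have hxy : f x = f y := le_antisymm (not_lt.1 fun h' => (hlt y x h').ne h.symm)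
    (not_lt.1 fun h' => (hlt x y h').ne h)
  simpa [hxy, hσi.eq_iff] using h

theorem exists_measurableEquiv_uniform_levels (μ : Measure X) [IsProbabilityMeasure μ]
    [NullSingletonClass μ] {f : X → ℕ} (hf : Measurable f) :
    ∃ e : X ≃ᵐ ℝ, MeasurePreserving e μ uniformMeasure ∧
      ∀ᵐ x ∂μ, e x ∈ Ioo (μ.real {y | f y < f x}) (μ.real {y | f y < f x + 1}) := by
  obtain ⟨g, hg, hfg⟩ := exists_measurableEmbedding_real_strictMono hf
  obtain ⟨e, he, hae⟩ := exists_measurableEquiv_uniform μ hg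
  refine ⟨e, he, ?_⟩
  filter_upwards [hae, he.quasiMeasurePreserving.ae ((countable_range fun k =>
    μ.real {y | f y < k}).ae_notMem uniformMeasure)] with x hx hne
  have hlow : μ.real {y | f y < f x} ≤ e x := by
    rw [hx]
    exact measureReal_mono fun y hy => (hfg y x hy).le
  have hup : e x ≤ μ.real {y | f y < f x + 1} := by
    rw [hx]
    exact measureReal_mono fun y hy =>
      Nat.lt_succ_of_le (not_lt.1 fun h => (hfg x y h).not_ge hy)
  exact ⟨hlow.lt_of_ne fun h => hne ⟨_, h⟩, hup.lt_of_ne fun h => hne ⟨_, h.symm⟩⟩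

theorem exists_measurableEquiv_levels
    {μ : Measure X} [IsProbabilityMeasure μ] [NullSingletonClass μ]
    {ν : Measure Y} [IsProbabilityMeasure ν] [NullSingletonClass ν]
    {f : X → ℕ} (hf : Measurable f) {g : Y → ℕ} (hg : Measurable g)
    (hfg : μ.map f = ν.map g) :
    ∃ θ : X ≃ᵐ Y, MeasurePreserving θ μ ν ∧ ∀ᵐ x ∂μ, g (θ x) = f x := by
  obtain ⟨e, he, hae⟩ := exists_measurableEquiv_uniform_levels μ hf
  obtain ⟨e', he', hae'⟩ := exists_measurableEquiv_uniform_levels ν hg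
  have hlevel : ∀ k, ν.real {y | g y < k} = μ.real {x | f x < k} := fun k => by
    change ν.real (g ⁻¹' Iio k) = μ.real (f ⁻¹' Iio k)
    rw [← map_measureReal_apply hg measurableSet_Iio, ← hfg,
      map_measureReal_apply hf measurableSet_Iio]
  have hθ : MeasurePreserving (e.trans e'.symm) μ ν := (he'.symm e').comp he
  refine ⟨e.trans e'.symm, hθ, ?_⟩
  have hmono : Monotone fun k => μ.real {x | f x < k} := fun k l hkl =>
    measureReal_mono fun x (hx : f x < k) => hx.trans_le hkl
  filter_upwards [hae, hθ.quasiMeasurePreserving.ae hae'] with x hx hx'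
  simp only [MeasurableEquiv.trans_apply, MeasurableEquiv.apply_symm_apply, hlevel] at hx' ⊢
  by_contra hne
  exact disjoint_left.1 (hmono.pairwise_disjoint_on_Ioo_succ hne) hx' hx

theorem exists_measurable_code {Z ι : Type*} [MeasurableSpace Z] [Finite ι] {D : ι → Set Z}
    (hD : ∀ i, MeasurableSet (D i)) :
    ∃ f : Z → ℕ, Measurable f ∧ ∀ x y, f x = f y → ∀ i, x ∈ D i ↔ y ∈ D i := by
  have hmeas : Measurable fun x => ({i | x ∈ D i} : Set ι) :=
    measurable_set_iff.2 fun i => measurable_mem.2 (hD i)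
  refine ⟨fun x => (Finite.equivFin (Set ι) {i | x ∈ D i} : ℕ),
    (measurable_of_countable fun s : Set ι => (Finite.equivFin (Set ι) s : ℕ)).comp hmeas,
    fun x y h i => ?_⟩
  exact Set.ext_iff.1 ((Finite.equivFin (Set ι)).injective (Fin.ext h)) i

theorem nullSingletonClass_of_quasiMeasurePreserving {Z W : Type*} [MeasurableSpace Z]
    [MeasurableSpace W] {ν : Measure Z} {μ : Measure W} [NullSingletonClass μ] {p : Z → W}
    (hp : Measure.QuasiMeasurePreserving p ν μ) : NullSingletonClass ν :=
  ⟨fun z => measure_mono_null (t := p ⁻¹' {p z}) (by simp)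
    (hp.preimage_null (measure_singleton _))⟩

theorem exists_measurableEquiv_factor
    {μ : Measure X} [IsProbabilityMeasure μ] [NullSingletonClass μ] {ν : Measure Y}
    {p : Y → X} (hp : MeasurePreserving p ν μ)
    {ι : Type*} [Finite ι] {D : ι → Set X} (hD : ∀ i, MeasurableSet (D i)) :
    ∃ θ : X ≃ᵐ Y, MeasurePreserving θ μ ν ∧ ∀ᵐ x ∂μ, ∀ i, p (θ x) ∈ D i ↔ x ∈ D i := by
  have := nullSingletonClass_of_quasiMeasurePreserving hp.quasiMeasurePreserving
  have : IsProbabilityMeasure ν := ⟨by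
    rw [← preimage_univ (f := p), hp.measure_preimage nullMeasurableSet_univ, measure_univ]⟩
  obtain ⟨f, hf, hfD⟩ := exists_measurable_code hD
  obtain ⟨θ, hθ, hθf⟩ := exists_measurableEquiv_levels (μ := μ) (ν := ν) hf
    (hf.comp hp.measurable) (by rw [← Measure.map_map hf hp.measurable, hp.map_eq])
  exact ⟨θ, hθ, hθf.mono fun x hx => hfD _ _ hx⟩

theorem exists_measure_eq_half (μ : Measure X) [IsProbabilityMeasure μ] [NullSingletonClass μ] :
    ∃ B : Set X, MeasurableSet B ∧ μ.real B = 1 / 2 := by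
  obtain ⟨e, he, -⟩ := exists_measurableEquiv_uniform μ (measurableEmbedding_embeddingReal X)
  refine ⟨e ⁻¹' Iic (1 / 2), e.measurable measurableSet_Iic, ?_⟩
  rw [measureReal_def, he.measure_preimage measurableSet_Iic.nullMeasurableSet,
    uniformMeasure_Iic, min_eq_left (by norm_num), ENNReal.toReal_ofReal (by norm_num)]

end MeasureIsomorphism

/-! ### Itineraries and Hoeffding's inequality -/

section Itineraries

open ProbabilityTheory

/-- The set of points whose itinerary under `T` with respect to `B` differs at time `k` from the
word `w`; a word of length `n` is encoded by the set of times at which it asks for a visit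
to `B`. -/
def errorSet {X : Type*} (T : X → X) (B : Set X) {n : ℕ} (w : Set (Fin n)) (k : Fin n) : Set X :=
  {x | ¬ (T^[k] x ∈ B ↔ k ∈ w)}

open Classical in
/-- The Hamming distance between the itinerary of `x`, over the times `k < n`, and a word `w`. -/
def mismatch {X : Type*} (T : X → X) (B : Set X) {n : ℕ} (w : Set (Fin n)) (x : X) : ℕ :=
  (Finset.univ.filter fun k : Fin n => x ∈ errorSet T B w k).card

theorem errorSet_eq_or {X : Type*} (T : X → X) (B : Set X) {n : ℕ} (w : Set (Fin n))
    (k : Fin n) : errorSet T B w k = T^[k] ⁻¹' B ∨ errorSet T B w k = (T^[k] ⁻¹' B)ᶜ := by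
  by_cases hk : k ∈ w
  · exact .inr (by ext; simp [errorSet, hk])
  · exact .inl (by ext; simp [errorSet, hk])

theorem mismatch_congr {X Y : Type*} {T : X → X} {S : Y → Y} {B : Set X} {C : Set Y} {n : ℕ}
    (w : Set (Fin n)) {x : X} {y : Y} (h : ∀ k : Fin n, T^[k] x ∈ B ↔ S^[k] y ∈ C) :
    mismatch T B w x = mismatch S C w y := by
  classical
  refine congrArg Finset.card (Finset.filter_congr fun k _ => ?_)
  simp only [errorSet, mem_ofPred_eq, h k]

section AlmostEverywhere

variable {X Y : Type*} [MeasurableSpace Y] {ν : Measure Y}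

theorem ae_forall_iterate_semiconj {g : Y → Y} (hg : Measure.QuasiMeasurePreserving g ν ν)
    {T : X → X} {ψ : Y → X} (h : ∀ᵐ y ∂ν, ψ (g y) = T (ψ y)) :
    ∀ᵐ y ∂ν, ∀ k, ψ (g^[k] y) = T^[k] (ψ y) := by
  filter_upwards [ae_all_iff.2 fun k => (hg.iterate k).ae h] with y hy k
  induction k with
  | zero => rfl
  | succ k ih => rw [Function.iterate_succ_apply', hy, ih, Function.iterate_succ_apply']

theorem ae_mismatch_semiconj {g : Y → Y} (hg : Measure.QuasiMeasurePreserving g ν ν)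
    {T : X → X} {ψ : Y → X} (h : ∀ᵐ y ∂ν, ψ (g y) = T (ψ y)) (B : Set X) {n : ℕ}
    (w : Set (Fin n)) : ∀ᵐ y ∂ν, mismatch g (ψ ⁻¹' B) w y = mismatch T B w (ψ y) := by
  filter_upwards [ae_forall_iterate_semiconj hg h] with y hy
  refine mismatch_congr w fun k => ?_
  rw [mem_preimage, hy]

variable [MeasurableSpace X] {μ : Measure X}

theorem measurableSet_errorSet {T : X → X} (hT : Measurable T) {B : Set X} (hB : MeasurableSet B)
    {n : ℕ} (w : Set (Fin n)) (k : Fin n) : MeasurableSet (errorSet T B w k) := by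
  have hpre : MeasurableSet (T^[k] ⁻¹' B) := hT.iterate k hB
  rcases errorSet_eq_or T B w k with h | h <;> rw [h]
  exacts [hpre, hpre.compl]

theorem measureReal_errorSet [IsProbabilityMeasure μ] {T : X → X} (hT : MeasurePreserving T μ μ)
    {B : Set X} (hB : MeasurableSet B) (hB_half : μ.real B = 1 / 2) {n : ℕ} (w : Set (Fin n))
    (k : Fin n) : μ.real (errorSet T B w k) = 1 / 2 := by
  have hpre : μ.real (T^[k] ⁻¹' B) = 1 / 2 := by
    rw [(hT.iterate k).measureReal_preimage hB.nullMeasurableSet, hB_half]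
  rcases errorSet_eq_or T B w k with h | h <;> rw [h]
  · exact hpre
  · rw [probReal_compl_eq_one_sub (hT.measurable.iterate k hB), hpre]
    norm_num

theorem measurable_mismatch {T : X → X} (hT : Measurable T) {B : Set X} (hB : MeasurableSet B)
    {n : ℕ} (w : Set (Fin n)) : Measurable (mismatch T B w) := by
  classical
  unfold mismatch
  simp_rw [Finset.card_filter]
  exact Finset.measurable_sum _ fun k _ =>
    Measurable.ite (measurableSet_errorSet hT hB w k) measurable_const measurable_const

theorem ae_mismatch_congr_set {T : X → X} (hT : Measure.QuasiMeasurePreserving T μ μ)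
    {B C : Set X} (h : ∀ᵐ x ∂μ, x ∈ B ↔ x ∈ C) {n : ℕ} (w : Set (Fin n)) :
    mismatch T B w =ᵐ[μ] mismatch T C w := by
  filter_upwards [ae_all_iff.2 fun k => (hT.iterate k).ae h] with x hx
  exact mismatch_congr w fun k => hx k

end AlmostEverywhere

variable {Ω : Type*} [MeasurableSpace Ω] {P : Measure Ω}

theorem hasSubgaussianMGF_mono {Z : Ω → ℝ} {c c' : NNReal} (h : HasSubgaussianMGF Z c P)
    (hc : c ≤ c') : HasSubgaussianMGF Z c' P :=
  ⟨h.integrable_exp_mul, fun t => (h.mgf_le t).trans (by gcongr)⟩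

variable {ι κ X : Type*} [MeasurableSpace X] [IsProbabilityMeasure P] {Y : ι → Ω → X}

open Classical in
theorem measureReal_le_sum_le_exp [Fintype κ] (hY : ∀ i, Measurable (Y i)) (hindep : iIndepFun Y P)
    (idx : κ → ι) {L : ℕ} (hidx : ∀ i, (Finset.univ.filter fun k => idx k = i).card ≤ L)
    {f : κ → X → ℝ} (hf : ∀ k, Measurable (f k)) (hf_le : ∀ k y, |f k y| ≤ 1)
    (hf_int : ∀ k, ∫ ω, f k (Y (idx k) ω) ∂P = 0) {ε : ℝ} (hε : 0 ≤ ε) :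
    P.real {ω | ε ≤ ∑ k, f k (Y (idx k) ω)} ≤
      Real.exp (-ε ^ 2 / (2 * (L * Fintype.card κ))) := by
  let fiber : ι → Finset κ := fun i => Finset.univ.filter fun k => idx k = i
  let Z : ι → Ω → ℝ := fun i ω => ∑ k ∈ fiber i, f k (Y i ω)
  have hfY : ∀ k i, Measurable fun ω => f k (Y i ω) := fun k i => (hf k).comp (hY i)
  have hfint : ∀ k i, Integrable (fun ω => f k (Y i ω)) P := fun k i =>
    Integrable.of_bound (hfY k i).aestronglyMeasurable 1 (ae_of_all _ fun ω => hf_le k _)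
  have hZindep : iIndepFun Z P := hindep.comp (fun i y => ∑ k ∈ fiber i, f k y) fun i =>
    Finset.measurable_sum _ fun k _ => hf k
  have hZint : ∀ i, ∫ ω, Z i ω ∂P = 0 := fun i => by
    rw [integral_finsetSum _ fun k _ => hfint k i]
    refine Finset.sum_eq_zero fun k hk => ?_
    rw [← (Finset.mem_filter.1 hk).2, hf_int]
  have hZmem : ∀ i ω, Z i ω ∈ Icc (-((fiber i).card : ℝ)) (fiber i).card := fun i ω => by
    refine abs_le.1 ((Finset.abs_sum_le_sum_abs _ _).trans ?_)
    simpa using Finset.sum_le_card_nsmul _ _ 1 fun k (_ : k ∈ fiber i) => hf_le k (Y i ω)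
  have hZsubG : ∀ i ∈ Finset.univ.image idx, HasSubgaussianMGF (Z i) (L * (fiber i).card) P := by
    intro i _
    refine hasSubgaussianMGF_mono (hasSubgaussianMGF_of_mem_Icc_of_integral_eq_zero
      (Finset.measurable_sum _ fun k _ => hfY k i).aemeasurable
      (ae_of_all _ (hZmem i)) (hZint i)) ?_
    have hL : ((fiber i).card : NNReal) ≤ L := by exact_mod_cast hidx i
    simpa [sub_neg_eq_add, ← two_mul, nnnorm_mul, sq] using mul_le_mul_left hL _
  have hsum : ∀ ω, ∑ i ∈ Finset.univ.image idx, Z i ω = ∑ k, f k (Y (idx k) ω) := fun ω => by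
    rw [← Finset.sum_fiberwise_of_maps_to fun k hk => Finset.mem_image_of_mem idx hk]
    refine Finset.sum_congr rfl fun i _ => Finset.sum_congr rfl fun k hk => ?_
    rw [(Finset.mem_filter.1 hk).2]
  have hcard : ∑ i ∈ Finset.univ.image idx, (fiber i).card = Fintype.card κ :=
    (Finset.card_eq_sum_card_image idx Finset.univ).symm
  have h := HasSubgaussianMGF.measure_sum_ge_le_of_iIndepFun hZindep hZsubG hε
  simp only [hsum] at h
  rw [← Finset.mul_sum, ← Nat.cast_sum, hcard] at h
  exact_mod_cast h

open Classical in
theorem measureReal_card_mem_le_exp [Fintype κ] (hY : ∀ i, Measurable (Y i))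
    (hindep : iIndepFun Y P) (idx : κ → ι) {L : ℕ}
    (hidx : ∀ i, (Finset.univ.filter fun k => idx k = i).card ≤ L)
    {D : κ → Set X} (hD : ∀ k, MeasurableSet (D k))
    (hD_half : ∀ k, P.real (Y (idx k) ⁻¹' D k) = 1 / 2) :
    P.real {ω | 8 * (Finset.univ.filter fun k => Y (idx k) ω ∈ D k).card ≤ Fintype.card κ} ≤
      Real.exp (-(Fintype.card κ / (8 * L))) := by
  let f : κ → X → ℝ := fun k => (D k)ᶜ.indicator 1 - (D k).indicator 1
  have hf : ∀ k, Measurable (f k) := fun k =>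
    (measurable_one.indicator (hD k).compl).sub (measurable_one.indicator (hD k))
  have hf_le : ∀ k y, |f k y| ≤ 1 := fun k y => by
    by_cases hy : y ∈ D k <;> simp [f, hy]
  have hf_int : ∀ k, ∫ ω, f k (Y (idx k) ω) ∂P = 0 := fun k => by
    have hm := hY (idx k) (hD k)
    change ∫ ω, ((Y (idx k) ⁻¹' D k)ᶜ.indicator (1 : Ω → ℝ) ω -
      (Y (idx k) ⁻¹' D k).indicator 1 ω) ∂P = 0
    rw [integral_sub ((integrable_const 1).indicator hm.compl) ((integrable_const 1).indicator hm),
      integral_indicator_one hm.compl, integral_indicator_one hm,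
      probReal_compl_eq_one_sub hm, hD_half]
    norm_num
  have hsum : ∀ ω, ∑ k, f k (Y (idx k) ω) = Fintype.card κ -
      2 * (Finset.univ.filter fun k => Y (idx k) ω ∈ D k).card := fun ω => by
    have : ∀ k, f k (Y (idx k) ω) = 1 - 2 * if Y (idx k) ω ∈ D k then 1 else 0 := fun k => by
      by_cases hk : Y (idx k) ω ∈ D k <;> simp [f, hk]; norm_num
    simp only [this, Finset.sum_sub_distrib, ← Finset.mul_sum, Finset.sum_boole]
    simp
  have hoeffding := measureReal_le_sum_le_exp hY hindep idx hidx hf hf_le hf_int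
    (ε := 3 / 4 * Fintype.card κ) (by positivity)
  refine (measureReal_mono fun ω hω => ?_).trans (hoeffding.trans (Real.exp_le_exp.2 ?_))
  · have : 8 * ((Finset.univ.filter fun k => Y (idx k) ω ∈ D k).card : ℝ) ≤ Fintype.card κ := by
      exact_mod_cast hω
    rw [mem_ofPred_eq, hsum]
    linarith
  · have hexponent : (3 / 4 * (Fintype.card κ : ℝ)) ^ 2 / (2 * (L * Fintype.card κ)) =
        9 / 4 * (Fintype.card κ / (8 * L)) := by
      rcases eq_or_ne (Fintype.card κ : ℝ) 0 with h | h
      · simp [h]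
      · field_simp
        norm_num
    have hnonneg : (0 : ℝ) ≤ Fintype.card κ / (8 * L) := by positivity
    rw [neg_div, neg_le_neg_iff, hexponent]
    linarith

end Itineraries

/-! ### The tower over a Bernoulli scheme -/

section Tower

open ProbabilityTheory

/-- The index shift, performed when the clock strikes. -/
def towerShift {L : ℕ} (c : ZMod L) : ℤ := if c + 1 = 0 then 1 else 0

variable {X : Type*} [MeasurableSpace X]

/-- The tower of height `L` over the Bernoulli scheme with alphabet `X`: the clock `ZMod L` runs
cyclically, `T` acts on all the coordinates, and the coordinates are shifted when the clock
strikes, so that the orbit of the coordinate at the origin is resampled every `L` steps. -/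
def tower (T : X ≃ᵐ X) (L : ℕ) [NeZero L] : ZMod L × (ℤ → X) ≃ᵐ ZMod L × (ℤ → X) where
  toFun z := (z.1 + 1, fun i => T (z.2 (i + towerShift z.1)))
  invFun z := (z.1 - 1, fun i => T.symm (z.2 (i - towerShift (z.1 - 1))))
  left_inv z := by ext <;> simp
  right_inv z := by ext <;> simp
  measurable_toFun := by
    refine Measurable.prodMk ?_ (measurable_pi_iff.2 fun i => ?_)
    · exact (measurable_of_countable fun c : ZMod L => c + 1).comp measurable_fst
    · refine measurable_from_prod_countable_right fun c => ?_
      exact T.measurable.comp (measurable_pi_apply (i + towerShift c))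
  measurable_invFun := by
    refine Measurable.prodMk ?_ (measurable_pi_iff.2 fun i => ?_)
    · exact (measurable_of_countable fun c : ZMod L => c - 1).comp measurable_fst
    · refine measurable_from_prod_countable_right fun c => ?_
      exact T.symm.measurable.comp (measurable_pi_apply (i - towerShift (c - 1)))

/-- The invariant measure of the tower. -/
def towerMeasure (μ : Measure X) (L : ℕ) [NeZero L] : Measure (ZMod L × (ℤ → X)) :=
  (uniformOn univ).prod (Measure.infinitePi fun _ => μ)

/-- The factor map of the tower that reads the coordinate at the origin. -/
def towerProj (L : ℕ) (z : ZMod L × (ℤ → X)) : X := z.2 0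

theorem tower_apply (T : X ≃ᵐ X) (L : ℕ) [NeZero L] (z : ZMod L × (ℤ → X)) :
    tower T L z = (z.1 + 1, fun i => T (z.2 (i + towerShift z.1))) := rfl

theorem towerShift_add_div (L : ℕ) [NeZero L] (c : ZMod L) (k : ℕ) :
    towerShift (c + (k : ZMod L)) + ((c.val + k) / L : ℕ) = ((c.val + (k + 1)) / L : ℕ) := by
  have hstrike : c + (k : ZMod L) + 1 = 0 ↔ L ∣ c.val + k + 1 := by
    rw [← ZMod.natCast_eq_zero_iff]
    push_cast
    rw [ZMod.natCast_zmod_val]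
  rw [← add_assoc, Nat.succ_div, towerShift, add_comm]
  by_cases h : L ∣ c.val + k + 1 <;> simp [hstrike, h]

theorem tower_iterate (T : X ≃ᵐ X) (L : ℕ) [NeZero L] (z : ZMod L × (ℤ → X)) (k : ℕ) :
    (tower T L)^[k] z = (z.1 + k, fun i => T^[k] (z.2 (i + ((z.1.val + k) / L : ℕ)))) := by
  induction k with
  | zero => simp [Nat.div_eq_of_lt (ZMod.val_lt z.1)]
  | succ k ih =>
    rw [Function.iterate_succ_apply', ih, tower_apply]
    refine Prod.ext (by push_cast; ring) (funext fun i => ?_)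
    simp only
    rw [Function.iterate_succ_apply', add_assoc, towerShift_add_div]

theorem towerProj_tower {T : X ≃ᵐ X} {L : ℕ} [NeZero L] {z : ZMod L × (ℤ → X)}
    (hz : z.1 + 1 ≠ 0) : towerProj L (tower T L z) = T (towerProj L z) := by
  simp [tower_apply, towerProj, towerShift, hz]

theorem measurePreserving_uniformOn_univ {α : Type*} [Finite α] [MeasurableSpace α]
    [MeasurableSingletonClass α] (e : α ≃ α) :
    MeasurePreserving e (uniformOn univ) (uniformOn univ) := by
  cases nonempty_fintype α
  have he : Measurable e := measurable_of_countable e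
  refine ⟨he, Measure.ext fun s hs => ?_⟩
  rw [Measure.map_apply he hs, uniformOn_univ, uniformOn_univ,
    ← Measure.count_injective_image e.injective, e.image_preimage]

variable (μ : Measure X) [IsProbabilityMeasure μ]

theorem measurePreserving_infinitePi_reindex {ι : Type*} (e : ι ≃ ι) :
    MeasurePreserving (fun (x : ι → X) i => x (e i)) (Measure.infinitePi fun _ => μ)
      (Measure.infinitePi fun _ => μ) := by
  refine ⟨measurable_pi_iff.2 fun i => measurable_pi_apply _, ?_⟩
  have hpiCongr : (fun (x : ι → X) i => x (e i)) =
      MeasurableEquiv.piCongrLeft (fun _ => X) e.symm := by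
    ext x i
    have := Equiv.piCongrLeft_apply_apply (fun _ => X) e.symm x (e i)
    rw [e.symm_apply_apply] at this
    exact this.symm
  rw [hpiCongr]
  exact Measure.infinitePi_map_piCongrLeft (fun _ : ι => μ) e.symm

variable {μ}

theorem measurePreserving_infinitePi {ι : Type*} {T : X → X} (hT : MeasurePreserving T μ μ) :
    MeasurePreserving (fun (x : ι → X) i => T (x i)) (Measure.infinitePi fun _ => μ)
      (Measure.infinitePi fun _ => μ) := by
  refine ⟨measurable_pi_iff.2 fun i => hT.measurable.comp (measurable_pi_apply _), ?_⟩
  rw [Measure.infinitePi_map_pi (fun _ : ι => μ) (f := fun _ => T) fun _ => hT.measurable]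
  simp_rw [hT.map_eq]

section Measure

variable (μ) (L : ℕ) [NeZero L]

instance : IsProbabilityMeasure (uniformOn (univ : Set (ZMod L))) :=
  isProbabilityMeasure_uniformOn finite_univ univ_nonempty

instance : IsProbabilityMeasure (towerMeasure μ L) := by
  unfold towerMeasure; infer_instance

theorem measurePreserving_tower {T : X ≃ᵐ X} (hT : MeasurePreserving T μ μ) :
    MeasurePreserving (tower T L) (towerMeasure μ L) (towerMeasure μ L) := by
  refine MeasurePreserving.skew_product (f := fun c : ZMod L => c + 1)
    (g := fun c (x : ℤ → X) i => T (x (i + towerShift c)))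
    (measurePreserving_uniformOn_univ (Equiv.addRight 1)) ?_ (Eventually.of_forall fun c => ?_)
  · refine measurable_from_prod_countable_right fun c => measurable_pi_iff.2 fun i => ?_
    exact T.measurable.comp (measurable_pi_apply (i + towerShift c))
  · exact ((measurePreserving_infinitePi hT).comp
      (measurePreserving_infinitePi_reindex μ (Equiv.addRight (towerShift c)))).map_eq

theorem measurePreserving_towerProj : MeasurePreserving (towerProj L) (towerMeasure μ L) μ :=
  (measurePreserving_eval_infinitePi (fun _ : ℤ => μ) 0).comp measurePreserving_snd

theorem measurableSet_clock_strike :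
    MeasurableSet {z : ZMod L × (ℤ → X) | z.1 + 1 = 0} :=
  (measurable_of_countable fun c : ZMod L => c + 1).comp measurable_fst
    (measurableSet_singleton 0)

theorem towerMeasure_clock_strike : (towerMeasure μ L).real {z | z.1 + 1 = 0} = 1 / L := by
  have hprod : {z : ZMod L × (ℤ → X) | z.1 + 1 = 0} = ({-1} : Set (ZMod L)) ×ˢ univ := by
    ext z
    simp [eq_neg_iff_add_eq_zero]
  rw [hprod, towerMeasure, measureReal_prod_prod, probReal_univ, mul_one, measureReal_def,
    uniformOn_univ, Measure.count_singleton, ZMod.card]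
  simp

end Measure

theorem card_filter_div_eq_le {L : ℕ} (hL : 0 < L) (a n : ℕ) (i : ℤ) :
    (Finset.univ.filter fun k : Fin n => (((a + k) / L : ℕ) : ℤ) = i).card ≤ L := by
  calc (Finset.univ.filter fun k : Fin n => (((a + k) / L : ℕ) : ℤ) = i).card
      ≤ (Finset.Ico (i.toNat * L) (i.toNat * L + L)).card := by
        refine Finset.card_le_card_of_injOn (fun k : Fin n => a + k) (fun k hk => ?_)
          fun k _ l _ h => Fin.ext (Nat.add_left_cancel h)
        have hdiv : (a + k) / L = i.toNat := by
          rw [← (Finset.mem_filter.1 hk).2, Int.toNat_natCast]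
        rw [Finset.coe_Ico, mem_Ico, ← hdiv]
        exact ⟨Nat.div_mul_le_self _ L, Nat.lt_div_mul_add hL⟩
    _ = L := by simp

open Classical in
theorem mismatch_tower (T : X ≃ᵐ X) (L : ℕ) [NeZero L] (B : Set X) {n : ℕ} (w : Set (Fin n))
    (z : ZMod L × (ℤ → X)) :
    mismatch (tower T L) (towerProj L ⁻¹' B) w z = (Finset.univ.filter fun k : Fin n =>
      z.2 ((z.1.val + k) / L : ℕ) ∈ errorSet T B w k).card := by
  refine congrArg Finset.card (Finset.filter_congr fun k _ => ?_)
  simp only [errorSet, mem_ofPred_eq, mem_preimage, towerProj, tower_iterate, zero_add]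

theorem measureReal_prod_le_of_forall {α β : Type*} [MeasurableSpace α] [MeasurableSpace β]
    {P : Measure α} {Q : Measure β} [IsProbabilityMeasure P] [IsProbabilityMeasure Q]
    {s : Set (α × β)} (hs : MeasurableSet s) {c : ℝ} (hc : ∀ a, Q.real (Prod.mk a ⁻¹' s) ≤ c) :
    (P.prod Q).real s ≤ c := by
  have := nonempty_of_isProbabilityMeasure P
  have hc_nonneg : 0 ≤ c := measureReal_nonneg.trans (hc (Classical.arbitrary α))
  refine ENNReal.toReal_le_of_le_ofReal hc_nonneg ?_
  rw [Measure.prod_apply hs]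
  calc ∫⁻ a, Q (Prod.mk a ⁻¹' s) ∂P ≤ ∫⁻ _, ENNReal.ofReal c ∂P :=
        lintegral_mono fun a => (ofReal_measureReal (μ := Q)).symm.trans_le
          (ENNReal.ofReal_le_ofReal (hc a))
    _ = ENNReal.ofReal c := by simp

theorem towerMeasure_mismatch_le_exp (L : ℕ) [NeZero L] {T : X ≃ᵐ X}
    (hT : MeasurePreserving T μ μ) {B : Set X} (hB : MeasurableSet B) (hB_half : μ.real B = 1 / 2)
    {n : ℕ} (w : Set (Fin n)) :
    (towerMeasure μ L).real {z | 8 * mismatch (tower T L) (towerProj L ⁻¹' B) w z ≤ n} ≤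
      Real.exp (-(n / (8 * L))) := by
  classical
  have hp := measurePreserving_towerProj μ L
  have hmeas : MeasurableSet {z | 8 * mismatch (tower T L) (towerProj L ⁻¹' B) w z ≤ n} :=
    (measurable_mismatch (tower T L).measurable (hp.measurable hB) w).const_mul 8 measurableSet_Iic
  refine measureReal_prod_le_of_forall hmeas fun c => ?_
  have heval : ∀ i : ℤ, MeasurePreserving (Function.eval i) (Measure.infinitePi fun _ => μ) μ :=
    measurePreserving_eval_infinitePi fun _ => μ
  have herror := fun k => measurableSet_errorSet T.measurable hB w k
  have h := measureReal_card_mem_le_exp (fun i => (heval i).measurable)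
    (iIndepFun_infinitePi (P := fun _ : ℤ => μ) (X := fun _ => id) fun _ => measurable_id)
    (fun k : Fin n => (((c.val + k) / L : ℕ) : ℤ))
    (L := L) (fun i => by
      convert card_filter_div_eq_le (Nat.pos_of_ne_zero (NeZero.ne L)) c.val n i) herror
    fun k => by
      rw [(heval _).measureReal_preimage (herror k).nullMeasurableSet,
        measureReal_errorSet hT hB hB_half]
  simpa only [preimage_ofPred_eq, mismatch_tower, Fintype.card_fin] using h

end Tower

/-! ### Perturbing an automorphism -/

section Perturbation

open ProbabilityTheory

variable {X Y : Type*} [MeasurableSpace X] [MeasurableSpace Y] {μ : Measure X} {ν : Measure Y}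

/-- The automorphism of `(X, μ)` that corresponds to `τ` under an isomorphism `θ`. -/
def MPEquiv.pullback {θ : X ≃ᵐ Y} (hθ : MeasurePreserving θ μ ν) {τ : Y ≃ᵐ Y}
    (hτ : MeasurePreserving τ ν ν) : MPEquiv μ :=
  ⟨θ.trans (τ.trans θ.symm), (hθ.symm θ).comp (hτ.comp hθ)⟩

theorem MPEquiv.apply_pullback {θ : X ≃ᵐ Y} (hθ : MeasurePreserving θ μ ν) {τ : Y ≃ᵐ Y}
    (hτ : MeasurePreserving τ ν ν) (x : X) : θ ((pullback hθ hτ).1 x) = τ (θ x) :=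
  θ.apply_symm_apply _

variable {p : Y → X} {θ : X ≃ᵐ Y} {τ : Y ≃ᵐ Y}

theorem measureReal_pullback_symmDiff_le [IsFiniteMeasure μ] (hθ : MeasurePreserving θ μ ν)
    (hτ : MeasurePreserving τ ν ν) {T : X → X} {E : Set Y} (hE : MeasurableSet E)
    (hτE : ∀ y ∉ E, p (τ y) = T (p y)) {C : Set X} (hC : ∀ᵐ x ∂μ, p (θ x) ∈ C ↔ x ∈ C)
    (hTC : ∀ᵐ x ∂μ, p (θ x) ∈ T ⁻¹' C ↔ x ∈ T ⁻¹' C) :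
    μ.real (((MPEquiv.pullback hθ hτ).1 ⁻¹' C) ∆ (T ⁻¹' C)) ≤ ν.real E := by
  let S := MPEquiv.pullback hθ hτ
  have hsub : ((S.1 ⁻¹' C) ∆ (T ⁻¹' C) : Set X) ≤ᵐ[μ] θ ⁻¹' E := by
    filter_upwards [S.2.quasiMeasurePreserving.ae hC, hTC] with x hSx hTx
    intro hx
    by_contra hxE
    rw [MPEquiv.apply_pullback, hτE _ hxE] at hSx
    have hiff : S.1 x ∈ C ↔ T x ∈ C := hSx.symm.trans hTx
    exact hx.elim (fun h => h.2 (hiff.1 h.1)) fun h => h.2 (hiff.2 h.1)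
  rw [← hθ.measureReal_preimage hE.nullMeasurableSet]
  exact ENNReal.toReal_mono (measure_ne_top _ _) (measure_mono_ae hsub)

theorem identDistrib_mismatch_pullback (hθ : MeasurePreserving θ μ ν)
    (hτ : MeasurePreserving τ ν ν) (hp : Measurable p) {B : Set X} (hB : MeasurableSet B)
    (hθB : ∀ᵐ x ∂μ, p (θ x) ∈ B ↔ x ∈ B) {n : ℕ} (w : Set (Fin n)) :
    IdentDistrib (mismatch (MPEquiv.pullback hθ hτ).1 B w) (mismatch τ (p ⁻¹' B) w) μ ν := by
  let S := MPEquiv.pullback hθ hτ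
  have hmeas := measurable_mismatch τ.measurable (hp hB) w
  have hae : mismatch S.1 B w =ᵐ[μ] mismatch τ (p ⁻¹' B) w ∘ θ := by
    filter_upwards [ae_mismatch_congr_set S.2.quasiMeasurePreserving hθB w,
      ae_mismatch_semiconj S.2.quasiMeasurePreserving
        (Eventually.of_forall (MPEquiv.apply_pullback hθ hτ)) (p ⁻¹' B) w] with x hB' hθ'
    exact hB'.symm.trans hθ'
  refine ⟨(measurable_mismatch S.1.measurable hB w).aemeasurable, hmeas.aemeasurable, ?_⟩
  rw [Measure.map_congr hae, ← Measure.map_map hmeas hθ.measurable, hθ.map_eq]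

theorem exists_perturbation_of_extension [StandardBorelSpace X] [StandardBorelSpace Y]
    [IsProbabilityMeasure μ] [NullSingletonClass μ] (hp : MeasurePreserving p ν μ)
    (hτ : MeasurePreserving τ ν ν) (T : MPEquiv μ) {E : Set Y} (hE : MeasurableSet E)
    (hτE : ∀ y ∉ E, p (τ y) = T.1 (p y)) {B : Set X} (hB : MeasurableSet B)
    {ι : Type*} [Finite ι] {C : ι → Set X} (hC : ∀ j, MeasurableSet (C j)) :
    ∃ S : MPEquiv μ, (∀ j, μ.real ((S.1 ⁻¹' C j) ∆ (T.1 ⁻¹' C j)) ≤ ν.real E) ∧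
      ∀ (n : ℕ) (w : Set (Fin n)),
        IdentDistrib (mismatch S.1 B w) (mismatch τ (p ⁻¹' B) w) μ ν := by
  let D : Option (ι ⊕ ι) → Set X := fun o => o.elim B (Sum.elim C fun j => T.1 ⁻¹' C j)
  have hD : ∀ o, MeasurableSet (D o) := by
    rintro (_ | j | j)
    exacts [hB, hC j, T.1.measurable (hC j)]
  obtain ⟨θ, hθ, hθD⟩ := exists_measurableEquiv_factor hp hD
  exact ⟨MPEquiv.pullback hθ hτ,
    fun j => measureReal_pullback_symmDiff_le hθ hτ hE hτE
      (hθD.mono fun x hx => hx (some (.inl j))) (hθD.mono fun x hx => hx (some (.inr j))),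
    fun _ => identDistrib_mismatch_pullback hθ hτ hp.measurable hB
      (hθD.mono fun x hx => hx none)⟩

theorem exists_perturbation [StandardBorelSpace X] [IsProbabilityMeasure μ]
    [NullSingletonClass μ] (T : MPEquiv μ) {B : Set X} (hB : MeasurableSet B)
    (hB_half : μ.real B = 1 / 2) {ι : Type*} [Finite ι] {C : ι → Set X}
    (hC : ∀ j, MeasurableSet (C j)) (L : ℕ) [NeZero L] :
    ∃ S : MPEquiv μ, (∀ j, μ.real ((S.1 ⁻¹' C j) ∆ (T.1 ⁻¹' C j)) ≤ 1 / L) ∧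
      ∀ (n : ℕ) (w : Set (Fin n)), μ.real {x | 8 * mismatch S.1 B w x ≤ n} ≤
        Real.exp (-(n / (8 * L))) := by
  obtain ⟨S, hS_close, hS_mismatch⟩ := exists_perturbation_of_extension
    (measurePreserving_towerProj μ L) (measurePreserving_tower μ L T.2) T
    (measurableSet_clock_strike L) (fun z => towerProj_tower) hB hC
  refine ⟨S, fun j => (hS_close j).trans_eq (towerMeasure_clock_strike μ L), fun n w => ?_⟩
  have h := (hS_mismatch n w).measure_mem_eq (s := {a | 8 * a ≤ n}) (.of_discrete)
  rw [measureReal_def, show μ {x | 8 * mismatch S.1 B w x ≤ n} = _ from h]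
  exact towerMeasure_mismatch_le_exp L T.2 hB hB_half w

end Perturbation

/-! ### Complex itineraries -/

section Complex

variable {X Y : Type*} [MeasurableSpace X] [MeasurableSpace Y] {μ : Measure X} {ν : Measure Y}

/-- `T` is complex at scale `m` if no word of length `m ^ 2` is within relative Hamming distance
`1 / 8` of the itineraries of a set of measure `2 ^ -(m + 1)`; in particular `2 ^ m` words do not
suffice to describe the itineraries of half of the points up to this distance. -/
def IsComplexAt (μ : Measure X) (T : X → X) (B : Set X) (m : ℕ) : Prop :=
  ∀ w : Set (Fin (m ^ 2)), μ.real {x | 8 * mismatch T B w x ≤ m ^ 2} < (1 / 2) ^ (m + 1)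

theorem isComplexAt_preimage_iff {g : Y → Y} (hg : Measure.QuasiMeasurePreserving g ν ν)
    {T : X → X} (hT : Measurable T) {ψ : Y → X} (hψ : MeasurePreserving ψ ν μ)
    (h : ∀ᵐ y ∂ν, ψ (g y) = T (ψ y)) {B : Set X} (hB : MeasurableSet B) {m : ℕ} :
    IsComplexAt ν g (ψ ⁻¹' B) m ↔ IsComplexAt μ T B m := by
  refine forall_congr' fun w => ?_
  have hmeas : MeasurableSet {x | 8 * mismatch T B w x ≤ m ^ 2} :=
    (measurable_mismatch hT hB w).const_mul 8 measurableSet_Iic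
  have hae : ({y | 8 * mismatch g (ψ ⁻¹' B) w y ≤ m ^ 2} : Set Y) =ᵐ[ν]
      ψ ⁻¹' {x | 8 * mismatch T B w x ≤ m ^ 2} := by
    filter_upwards [ae_mismatch_semiconj hg h B w] with y hy
    exact congrArg (8 * · ≤ m ^ 2) hy
  rw [measureReal_congr hae, hψ.measureReal_preimage hmeas.nullMeasurableSet]

theorem isComplexAt_congr {S T : MPEquiv μ} (h : S ≈ T) {B : Set X} {m : ℕ}
    (hB : MeasurableSet B) : IsComplexAt μ S.1 B m ↔ IsComplexAt μ T.1 B m :=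
  isComplexAt_preimage_iff S.2.quasiMeasurePreserving T.1.measurable (.id μ) h hB

/-- The automorphisms all of whose representatives are complex at scale `m`. -/
def complexSet (μ : Measure X) (B : Set X) (m : ℕ) : Set (Aut μ) :=
  {T | ∀ S : MPEquiv μ, (Quotient.mk (aeSetoid μ) S : Aut μ) = T → IsComplexAt μ S.1 B m}

theorem mk_mem_complexSet {B : Set X} (hB : MeasurableSet B) {m : ℕ} {T : MPEquiv μ} :
    (Quotient.mk (aeSetoid μ) T : Aut μ) ∈ complexSet μ B m ↔ IsComplexAt μ T.1 B m :=
  ⟨fun h => h T rfl, fun h _ hS => (isComplexAt_congr (Quotient.exact hS) hB).2 h⟩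

end Complex

/-! ### Genericity of complex itineraries -/

section Generic

open scoped Topology

variable {X : Type*} [MeasurableSpace X] {μ : Measure X} {A : ℕ → Set X}

/-- The filter of neighbourhoods of `T` for the Halmos metric on representatives. -/
def halmosNhds (μ : Measure X) (A : ℕ → Set X) (T : MPEquiv μ) : Filter (MPEquiv μ) :=
  comap (fun S => preHalmosDist μ A S T) (𝓝 0)

theorem halmosTerm_nonneg (S T : MPEquiv μ) (i : ℕ) : 0 ≤ halmosTerm μ A S T i :=
  add_nonneg measureReal_nonneg measureReal_nonneg

theorem exists_ball_of_eventually_halmosNhds {T : MPEquiv μ} {p : MPEquiv μ → Prop}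
    (h : ∀ᶠ S in halmosNhds μ A T, p S) : ∃ ε > 0, ∀ S, preHalmosDist μ A S T < ε → p S := by
  rw [halmosNhds, eventually_comap, Metric.eventually_nhds_iff] at h
  obtain ⟨ε, hε, h⟩ := h
  refine ⟨ε, hε, fun S hS => h ?_ S rfl⟩
  have hnonneg : 0 ≤ preHalmosDist μ A S T := tsum_nonneg fun i =>
    mul_nonneg (by positivity) (halmosTerm_nonneg S T i)
  rwa [Real.dist_eq, sub_zero, abs_of_nonneg hnonneg]

theorem measureReal_preimage_symmDiff (S : MPEquiv μ) (s t : Set X) :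
    μ.real ((S.1 ⁻¹' s) ∆ (S.1 ⁻¹' t)) = μ.real (s ∆ t) := by
  rw [← preimage_symmDiff, measureReal_def, S.2.measure_preimage_equiv, measureReal_def]

theorem measureReal_image_symmDiff (S T : MPEquiv μ) (C : Set X) :
    μ.real ((S.1 '' C) ∆ (T.1 '' C)) =
      μ.real ((S.1 ⁻¹' (T.1 '' C)) ∆ (T.1 ⁻¹' (T.1 '' C))) := by
  rw [← measureReal_preimage_symmDiff S, preimage_image_eq _ S.1.injective,
    preimage_image_eq _ T.1.injective, symmDiff_comm]

variable [IsProbabilityMeasure μ]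

theorem halmosTerm_le_two (S T : MPEquiv μ) (i : ℕ) : halmosTerm μ A S T i ≤ 2 :=
  (add_le_add measureReal_le_one measureReal_le_one).trans_eq one_add_one_eq_two

theorem measureReal_symmDiff_triangle (s t u : Set X) :
    μ.real (s ∆ u) ≤ μ.real (s ∆ t) + μ.real (t ∆ u) :=
  (measureReal_mono (symmDiff_triangle _ _ _)).trans (measureReal_union_le _ _)

theorem measureReal_preimage_symmDiff_le_preHalmosDist (S T : MPEquiv μ) (i : ℕ) :
    μ.real ((S.1 ⁻¹' A i) ∆ (T.1 ⁻¹' A i)) ≤ 2 ^ (i + 1) * preHalmosDist μ A S T := by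
  have hterm : (1 / 2 : ℝ) ^ (i + 1) * halmosTerm μ A S T i ≤ preHalmosDist μ A S T :=
    (summable_halmos μ A S T).le_tsum i fun j _ =>
      mul_nonneg (by positivity) (halmosTerm_nonneg S T j)
  calc μ.real ((S.1 ⁻¹' A i) ∆ (T.1 ⁻¹' A i)) ≤ halmosTerm μ A S T i :=
        le_add_of_nonneg_left measureReal_nonneg
    _ = 2 ^ (i + 1) * ((1 / 2 : ℝ) ^ (i + 1) * halmosTerm μ A S T i) := by
        rw [← mul_assoc, ← mul_pow]
        norm_num
    _ ≤ 2 ^ (i + 1) * preHalmosDist μ A S T := mul_le_mul_of_nonneg_left hterm (by positivity)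

theorem tendsto_measureReal_preimage_symmDiff (hA : IsDenseFamily μ A) (T : MPEquiv μ)
    {C : Set X} (hC : MeasurableSet C) :
    Tendsto (fun S : MPEquiv μ => μ.real ((S.1 ⁻¹' C) ∆ (T.1 ⁻¹' C))) (halmosNhds μ A T)
      (𝓝 0) := by
  refine tendsto_order.2 ⟨fun a ha => Eventually.of_forall fun _ => ha.trans_le measureReal_nonneg,
    fun η hη => ?_⟩
  obtain ⟨i, hi⟩ := hA.2 C hC (η / 4) (by positivity)
  have hdist : Tendsto (fun S => 2 ^ (i + 1) * preHalmosDist μ A S T) (halmosNhds μ A T)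
      (𝓝 (2 ^ (i + 1) * 0)) := tendsto_comap.const_mul _
  rw [mul_zero] at hdist
  filter_upwards [hdist.eventually (gt_mem_nhds (by positivity : 0 < η / 4))] with S hS
  have hSC := measureReal_preimage_symmDiff S C (A i)
  have hTC := measureReal_preimage_symmDiff T (A i) C
  rw [symmDiff_comm] at hSC
  calc μ.real ((S.1 ⁻¹' C) ∆ (T.1 ⁻¹' C))
      ≤ μ.real ((S.1 ⁻¹' C) ∆ (S.1 ⁻¹' A i)) +
          (μ.real ((S.1 ⁻¹' A i) ∆ (T.1 ⁻¹' A i)) + μ.real ((T.1 ⁻¹' A i) ∆ (T.1 ⁻¹' C))) :=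
        (measureReal_symmDiff_triangle _ _ _).trans
          (add_le_add_right (measureReal_symmDiff_triangle _ _ _) _)
    _ = μ.real (A i ∆ C) + (μ.real ((S.1 ⁻¹' A i) ∆ (T.1 ⁻¹' A i)) + μ.real (A i ∆ C)) := by
        rw [hTC, symmDiff_comm, hSC, symmDiff_comm]
    _ < η := by linarith [measureReal_preimage_symmDiff_le_preHalmosDist (A := A) S T i]

theorem tendsto_measureReal_iterate_preimage_symmDiff (hA : IsDenseFamily μ A) (T : MPEquiv μ)
    {B : Set X} (hB : MeasurableSet B) (k : ℕ) :
    Tendsto (fun S : MPEquiv μ => μ.real ((S.1^[k] ⁻¹' B) ∆ (T.1^[k] ⁻¹' B))) (halmosNhds μ A T)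
      (𝓝 0) := by
  induction k with
  | zero => simpa using tendsto_const_nhds
  | succ k ih =>
    have hTk : MeasurableSet (T.1^[k] ⁻¹' B) := T.1.measurable.iterate k hB
    refine squeeze_zero (fun _ => measureReal_nonneg) (fun S => ?_)
      (by simpa using ih.add (tendsto_measureReal_preimage_symmDiff hA T hTk))
    rw [← measureReal_preimage_symmDiff S (S.1^[k] ⁻¹' B), Function.iterate_succ,
      Function.iterate_succ, preimage_comp, preimage_comp]
    exact measureReal_symmDiff_triangle _ _ _

theorem measureReal_mismatch_le_add_sum (S T : MPEquiv μ) (B : Set X) {n : ℕ} (w : Set (Fin n))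
    (q : ℕ) :
    μ.real {x | q * mismatch S.1 B w x ≤ n} ≤ μ.real {x | q * mismatch T.1 B w x ≤ n} +
      ∑ k : Fin n, μ.real ((S.1^[k] ⁻¹' B) ∆ (T.1^[k] ⁻¹' B)) := by
  have hsub : {x | q * mismatch S.1 B w x ≤ n} ⊆ {x | q * mismatch T.1 B w x ≤ n} ∪
      ⋃ k : Fin n, (S.1^[k] ⁻¹' B) ∆ (T.1^[k] ⁻¹' B) := by
    intro x hx
    by_cases h : ∃ k : Fin n, x ∈ (S.1^[k] ⁻¹' B) ∆ (T.1^[k] ⁻¹' B)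
    · exact .inr (mem_iUnion.2 h)
    · have hagree : ∀ k : Fin n, S.1^[k] x ∈ B ↔ T.1^[k] x ∈ B := fun k => by
        have := not_exists.1 h k
        simp only [mem_symmDiff, mem_preimage] at this
        tauto
      exact .inl ((congrArg (q * · ≤ n) (mismatch_congr w hagree)).mp hx)
  exact (measureReal_mono hsub).trans ((measureReal_union_le _ _).trans
    (add_le_add_right (measureReal_iUnion_fintype_le _) _))

theorem eventually_isComplexAt (hA : IsDenseFamily μ A) {B : Set X} (hB : MeasurableSet B)
    {m : ℕ} {T : MPEquiv μ} (hT : IsComplexAt μ T.1 B m) :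
    ∀ᶠ S : MPEquiv μ in halmosNhds μ A T, IsComplexAt μ S.1 B m := by
  refine eventually_all.2 fun w => ?_
  have hlim : Tendsto (fun S : MPEquiv μ => μ.real {x | 8 * mismatch T.1 B w x ≤ m ^ 2} +
      ∑ k : Fin (m ^ 2), μ.real ((S.1^[k] ⁻¹' B) ∆ (T.1^[k] ⁻¹' B))) (halmosNhds μ A T)
      (𝓝 (μ.real {x | 8 * mismatch T.1 B w x ≤ m ^ 2})) := by
    simpa using tendsto_const_nhds.add (tendsto_finsetSum Finset.univ fun (k : Fin (m ^ 2)) _ =>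
      tendsto_measureReal_iterate_preimage_symmDiff hA T hB k)
  filter_upwards [hlim.eventually (gt_mem_nhds (hT w))] with S hS
  exact (measureReal_mismatch_le_add_sum S T B w 8).trans_lt hS

theorem isOpen_complexSet (hA : IsDenseFamily μ A) {B : Set X} (hB : MeasurableSet B) (m : ℕ) :
    @IsOpen _ (halmosMetric μ A).toUniformSpace.toTopologicalSpace (complexSet μ B m) := by
  let _ := halmosMetric μ A
  rw [Metric.isOpen_iff]
  rintro ⟨T⟩ hT
  obtain ⟨ε, hε, hball⟩ := exists_ball_of_eventually_halmosNhds
    (eventually_isComplexAt hA hB ((mk_mem_complexSet hB).1 hT))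
  refine ⟨ε, hε, ?_⟩
  rintro ⟨S⟩ hS
  exact (mk_mem_complexSet hB).2 (hball S hS)

theorem tendsto_preHalmosDist_zero {α : Type*} {l : Filter α} {S : α → MPEquiv μ} {T : MPEquiv μ}
    (h : ∀ i, Tendsto (fun a => halmosTerm μ A (S a) T i) l (𝓝 0)) :
    Tendsto (fun a => preHalmosDist μ A (S a) T) l (𝓝 0) := by
  rw [← tsum_zero (α := ℝ) (β := ℕ) (L := .unconditional ℕ)]
  refine tendsto_tsum_of_dominated_convergence (bound := fun i : ℕ => (1 / 2 : ℝ) ^ i)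
    summable_geometric_two (fun i => ?_) (Eventually.of_forall fun a i => ?_)
  · simpa using (h i).const_mul ((1 / 2 : ℝ) ^ (i + 1))
  · rw [Real.norm_of_nonneg (mul_nonneg (by positivity) (halmosTerm_nonneg _ _ _))]
    calc (1 / 2 : ℝ) ^ (i + 1) * halmosTerm μ A (S a) T i ≤ (1 / 2 : ℝ) ^ (i + 1) * 2 :=
          mul_le_mul_of_nonneg_left (halmosTerm_le_two _ _ _) (by positivity)
      _ = (1 / 2 : ℝ) ^ i := by ring

theorem exp_neg_sq_div_lt_half_pow {L m : ℕ} (hL : 0 < L) (hm : 16 * L ≤ m) :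
    Real.exp (-(((m ^ 2 : ℕ) : ℝ) / (8 * L))) < (1 / 2 : ℝ) ^ (m + 1) := by
  have hL_one : (1 : ℝ) ≤ L := by exact_mod_cast hL
  have hm_real : (16 : ℝ) * L ≤ m := by exact_mod_cast hm
  have hpow : (1 / 2 : ℝ) ^ (m + 1) = Real.exp (-((m + 1 : ℕ) * Real.log 2)) := by
    rw [Real.exp_neg, Real.exp_nat_mul, Real.exp_log (by norm_num)]
    simp
  rw [hpow, Real.exp_lt_exp, neg_lt_neg_iff]
  calc ((m + 1 : ℕ) : ℝ) * Real.log 2 < (m + 1 : ℕ) * 1 :=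
        mul_lt_mul_of_pos_left (Real.log_two_lt_d9.trans (by norm_num)) (by positivity)
    _ ≤ 2 * m := by push_cast; linarith
    _ ≤ ((m ^ 2 : ℕ) : ℝ) / (8 * L) := by
        rw [le_div_iff₀ (by positivity)]
        push_cast
        nlinarith

variable [StandardBorelSpace X] [NullSingletonClass μ]

theorem exists_halmosTerm_le_isComplexAt (hA : ∀ i, MeasurableSet (A i)) {B : Set X}
    (hB : MeasurableSet B) (hB_half : μ.real B = 1 / 2) (T : MPEquiv μ) (l : ℕ) :
    ∃ S : MPEquiv μ, (∀ i ≤ l, halmosTerm μ A S T i ≤ 2 * (1 / ((l : ℝ) + 1))) ∧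
      ∀ m, 16 * (l + 1) ≤ m → IsComplexAt μ S.1 B m := by
  have hTA : ∀ i, MeasurableSet (T.1 '' A i) := fun i => T.1.measurableSet_image.2 (hA i)
  obtain ⟨S, hS_close, hS_mismatch⟩ := exists_perturbation T hB hB_half
    (C := Sum.elim (fun i : Fin (l + 1) => A i) fun i : Fin (l + 1) => T.1 '' A i)
    (by rintro (i | i); exacts [hA i, hTA i]) (l + 1)
  push_cast at hS_close
  refine ⟨S, fun i hi => ?_, fun m hm w => ?_⟩
  · have hpreimage := hS_close (.inl ⟨i, Nat.lt_succ_of_le hi⟩)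
    have himage := hS_close (.inr ⟨i, Nat.lt_succ_of_le hi⟩)
    simp only [Sum.elim_inl, Sum.elim_inr] at hpreimage himage
    rw [halmosTerm, measureReal_image_symmDiff]
    linarith
  · exact (hS_mismatch (m ^ 2) w).trans_lt (exp_neg_sq_div_lt_half_pow l.succ_pos hm)

theorem exists_seq_tendsto_isComplexAt (hA : ∀ i, MeasurableSet (A i)) {B : Set X}
    (hB : MeasurableSet B) (hB_half : μ.real B = 1 / 2) (T : MPEquiv μ) :
    ∃ S : ℕ → MPEquiv μ, Tendsto (fun l => preHalmosDist μ A (S l) T) atTop (𝓝 0) ∧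
      ∀ l m, 16 * (l + 1) ≤ m → IsComplexAt μ (S l).1 B m := by
  choose S hS_close hS_complex using exists_halmosTerm_le_isComplexAt hA hB hB_half T
  refine ⟨S, tendsto_preHalmosDist_zero fun i => ?_, hS_complex⟩
  have hlim : Tendsto (fun l : ℕ => 2 * (1 / ((l : ℝ) + 1))) atTop (𝓝 0) := by
    simpa using (tendsto_one_div_add_atTop_nhds_zero_nat (𝕜 := ℝ)).const_mul 2
  refine squeeze_zero' (Eventually.of_forall fun l => halmosTerm_nonneg _ _ _) ?_ hlim
  filter_upwards [eventually_ge_atTop i] with l hl using hS_close l i hl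

theorem isGenericProperty_frequently_mem_complexSet (hA : IsDenseFamily μ A) {B : Set X}
    (hB : MeasurableSet B) (hB_half : μ.real B = 1 / 2) :
    IsGenericProperty μ A fun T => ∃ᶠ m in atTop, T ∈ complexSet μ B m := by
  let _ := halmosMetric μ A
  refine ⟨⋂ N : ℕ, ⋃ m ≥ N, complexSet μ B m, ?_, ?_, ?_⟩
  · exact IsGδ.iInter_of_isOpen fun N => isOpen_biUnion fun m _ => isOpen_complexSet hA hB m
  · rw [Metric.dense_iff]
    rintro ⟨T⟩ ε hε
    obtain ⟨S, hS_lim, hS_complex⟩ := exists_seq_tendsto_isComplexAt hA.1 hB hB_half T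
    obtain ⟨l, hl⟩ := (hS_lim.eventually (gt_mem_nhds hε)).exists
    refine ⟨Quotient.mk _ (S l), hl, mem_iInter.2 fun N => mem_iUnion₂.2
      ⟨N + 16 * (l + 1), Nat.le_add_right _ _, (mk_mem_complexSet hB).2 ?_⟩⟩
    exact hS_complex l _ (Nat.le_add_left _ _)
  · intro T hT
    refine frequently_atTop.2 fun N => ?_
    simpa using mem_iInter.1 hT N

end Generic

/-! ### Counting words -/

section Counting

variable {X : Type*}

/-- The word of length `n` recording the visits of the orbit of `x` to `B`, encoded as in
`errorSet` by the set of times of the visits. -/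
def itinerary (T : X → X) (B : Set X) (n : ℕ) (x : X) : Set (Fin n) :=
  {k | T^[k] x ∈ B}

open Classical in
/-- The number of times `k < n` at which the orbit of `x` visits `Z`. -/
def visits (T : X → X) (Z : Set X) (n : ℕ) (x : X) : ℕ :=
  (Finset.univ.filter fun k : Fin n => T^[k] x ∈ Z).card

theorem mismatch_itinerary_le_visits_add_visits {T : X → X} {B Z : Set X} {n : ℕ} {x y : X}
    (h : ∀ k < n, T^[k] x ∉ Z → T^[k] y ∉ Z → (T^[k] x ∈ B ↔ T^[k] y ∈ B)) :
    mismatch T B (itinerary T B n y) x ≤ visits T Z n x + visits T Z n y := by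
  classical
  refine (Finset.card_le_card fun k hk => ?_).trans (Finset.card_union_le _ _)
  have hk_error : ¬ (T^[k] x ∈ B ↔ T^[k] y ∈ B) := (Finset.mem_filter.1 hk).2
  have hk_visit : T^[k] x ∈ Z ∨ T^[k] y ∈ Z := by
    by_contra! hk_avoid
    exact hk_error (h k k.2 hk_avoid.1 hk_avoid.2)
  simpa using hk_visit

theorem visits_eq_sum_indicator (T : X → X) (Z : Set X) (n : ℕ) (x : X) :
    (visits T Z n x : ℝ) = ∑ k : Fin n, (T^[k] ⁻¹' Z).indicator (fun _ => (1 : ℝ)) x := by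
  rw [visits, Finset.card_filter, Nat.cast_sum]
  exact Finset.sum_congr rfl fun k _ => by rw [Nat.cast_ite, Nat.cast_one, Nat.cast_zero]; rfl

variable [MeasurableSpace X] {μ : Measure X}

theorem integrable_visits [IsFiniteMeasure μ] {T : X → X} (hT : Measurable T) {Z : Set X}
    (hZ : MeasurableSet Z) (n : ℕ) : Integrable (fun x => (visits T Z n x : ℝ)) μ := by
  simp_rw [visits_eq_sum_indicator]
  exact integrable_finsetSum _ fun k _ => (integrable_const 1).indicator (hT.iterate k hZ)

theorem integral_visits [IsFiniteMeasure μ] {T : X → X} (hT : MeasurePreserving T μ μ)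
    {Z : Set X} (hZ : MeasurableSet Z) (n : ℕ) :
    ∫ x, (visits T Z n x : ℝ) ∂μ = n * μ.real Z := by
  have hpre : ∀ k, MeasurableSet (T^[k] ⁻¹' Z) := fun k => hT.measurable.iterate k hZ
  simp_rw [visits_eq_sum_indicator]
  rw [integral_finsetSum _ fun (k : Fin n) _ => (integrable_const 1).indicator (hpre k)]
  simp_rw [integral_indicator_const _ (hpre _),
    (hT.iterate _).measureReal_preimage hZ.nullMeasurableSet]
  simp

theorem measureReal_lt_mul_visits_le [IsFiniteMeasure μ] {T : X → X}
    (hT : MeasurePreserving T μ μ) {Z : Set X} (hZ : MeasurableSet Z) (n q : ℕ) :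
    μ.real {x | n < q * visits T Z n x} ≤ q * μ.real Z := by
  rcases n.eq_zero_or_pos with rfl | hn
  · simpa [visits] using mul_nonneg q.cast_nonneg measureReal_nonneg
  have hmarkov := mul_meas_ge_le_integral_of_nonneg
    (ae_of_all μ fun x => mul_nonneg q.cast_nonneg (visits T Z n x).cast_nonneg)
    ((integrable_visits hT.measurable hZ n).const_mul (q : ℝ)) n
  rw [integral_const_mul, integral_visits hT hZ, mul_left_comm] at hmarkov
  refine (measureReal_mono fun x hx => ?_).trans
    (le_of_mul_le_mul_left hmarkov (by exact_mod_cast hn))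
  exact_mod_cast (show n < q * visits T Z n x from hx).le

theorem measureReal_exists_iterate_mem_le [IsFiniteMeasure μ] {T : X → X}
    (hT : MeasurePreserving T μ μ) {U : Set X} (hU : NullMeasurableSet U μ) (n : ℕ) :
    μ.real {x | ∃ k < n, T^[k] x ∈ U} ≤ n * μ.real U := by
  have hunion : {x | ∃ k < n, T^[k] x ∈ U} = ⋃ k ∈ Finset.range n, T^[k] ⁻¹' U := by
    ext x
    simp
  calc μ.real {x | ∃ k < n, T^[k] x ∈ U} ≤ ∑ k ∈ Finset.range n, μ.real (T^[k] ⁻¹' U) :=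
        hunion ▸ measureReal_biUnion_finset_le _ _
    _ = n * μ.real U := by simp [(hT.iterate _).measureReal_preimage hU]

theorem not_isComplexAt_of_code [IsProbabilityMeasure μ] {T : X → X} {B : Set X} {m : ℕ}
    {G : Set X} (hG : μ.real Gᶜ < 1 / 2) {κ : Type*} (code : X → κ) {c : Finset κ}
    (hc : c.card ≤ 2 ^ m) (hcode : ∀ x ∈ G, code x ∈ c)
    (hclose : ∀ x ∈ G, ∀ y ∈ G, code x = code y →
      8 * mismatch T B (itinerary T B (m ^ 2) y) x ≤ m ^ 2) :
    ¬ IsComplexAt μ T B m := by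
  intro hcomplex
  have hcell : ∀ a ∈ c, μ.real {x ∈ G | code x = a} ≤ (1 / 2) ^ (m + 1) := by
    intro a _
    rcases ({x ∈ G | code x = a} : Set X).eq_empty_or_nonempty with hempty | ⟨y, hyG, rfl⟩
    · rw [hempty, measureReal_empty]
      positivity
    · exact (measureReal_mono fun x hx => hclose x hx.1 y hyG hx.2).trans
        (hcomplex (itinerary T B (m ^ 2) y)).le
  have hcover : G ⊆ ⋃ a ∈ c, {x ∈ G | code x = a} := fun x hx =>
    mem_iUnion₂.2 ⟨code x, hcode x hx, hx, rfl⟩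
  have hG_le : μ.real G ≤ 1 / 2 := by
    calc μ.real G ≤ ∑ a ∈ c, μ.real {x ∈ G | code x = a} :=
          (measureReal_mono hcover (measure_ne_top _ _)).trans
            (measureReal_biUnion_finset_le _ _)
      _ ≤ c.card * (1 / 2) ^ (m + 1) := by simpa using Finset.sum_le_sum hcell
      _ ≤ (2 : ℝ) ^ m * (1 / 2) ^ (m + 1) := by
          gcongr
          exact_mod_cast hc
      _ = 1 / 2 := by
          rw [pow_succ, ← mul_assoc, ← mul_pow]
          norm_num
  have hadd := measureReal_union_le (μ := μ) G Gᶜ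
  rw [union_compl_self, probReal_univ] at hadd
  linarith

end Counting

section Separation

variable {X : Type*} [MetricSpace X] [MeasurableSpace X] [BorelSpace X]

theorem exists_measureReal_le_separated {ν : Measure X} [IsFiniteMeasure ν]
    [ν.InnerRegularCompactLTTop] {B : Set X} (hB : MeasurableSet B) {ε : ℝ} (hε : 0 < ε) :
    ∃ Z : Set X, MeasurableSet Z ∧ ν.real Z ≤ ε ∧ ∃ δ > 0,
      ∀ y ∉ Z, ∀ z ∉ Z, dist y z < δ → (y ∈ B ↔ z ∈ B) := by
  have hε_half : ENNReal.ofReal (ε / 2) ≠ 0 := by simpa using hε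
  obtain ⟨K, hKB, hK, hK_lt⟩ := hB.exists_isCompact_sdiff_lt (measure_ne_top ν B) hε_half
  obtain ⟨K', hKB', hK', hK_lt'⟩ :=
    hB.compl.exists_isCompact_sdiff_lt (measure_ne_top ν Bᶜ) hε_half
  obtain ⟨δ, hδ, hdisj⟩ := (disjoint_compl_right.mono hKB hKB').exists_thickenings hK hK'.isClosed
  have hfar : ∀ y ∈ K, ∀ z ∈ K', ¬ dist y z < δ := fun y hy z hz hyz =>
    disjoint_left.1 hdisj (Metric.self_subset_thickening hδ K hy)
      (Metric.mem_thickening_iff.2 ⟨z, hz, hyz⟩)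
  refine ⟨(B \ K) ∪ (Bᶜ \ K'), (hB.diff hK.measurableSet).union
    (hB.compl.diff hK'.measurableSet), ?_, δ, hδ, fun y hy z hz hyz => ?_⟩
  · have hBK := ENNReal.toReal_le_of_le_ofReal (by positivity) hK_lt.le
    have hBK' := ENNReal.toReal_le_of_le_ofReal (by positivity) hK_lt'.le
    exact (measureReal_union_le _ _).trans ((add_le_add hBK hBK').trans_eq (add_halves ε))
  · have hmem_compact : ∀ x ∉ (B \ K) ∪ (Bᶜ \ K'), x ∈ B ∧ x ∈ K ∨ x ∉ B ∧ x ∈ K' := fun x hx => by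
      simp only [mem_union, Set.mem_sdiff, mem_compl_iff] at hx
      tauto
    rcases hmem_compact y hy with ⟨hyB, hyK⟩ | ⟨hyB, hyK⟩ <;>
      rcases hmem_compact z hz with ⟨hzB, hzK⟩ | ⟨hzB, hzK⟩
    · exact iff_of_true hyB hzB
    · exact absurd hyz (hfar y hyK z hzK)
    · exact absurd (dist_comm y z ▸ hyz) (hfar z hzK y hyK)
    · exact iff_of_false hyB hzB

end Separation

/-! ### Exchanges are locally isometric -/

section LocalIsometry

theorem subset_of_isPreconnected_of_disjoint_frontier {X : Type*} [TopologicalSpace X]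
    {s F : Set X} (hs : IsPreconnected s) (hdisj : Disjoint s (frontier F))
    (hne : (s ∩ F).Nonempty) : s ⊆ F := by
  have hint : ∀ x ∈ s, x ∈ closure F → x ∈ interior F := fun x hxs hxF => by
    by_contra hx
    exact disjoint_left.1 hdisj hxs ⟨hxF, hx⟩
  have hcover : s ⊆ interior F ∪ (closure F)ᶜ := fun x hxs =>
    (em (x ∈ closure F)).imp_left (hint x hxs)
  refine (hs.subset_left_of_subset_union isOpen_interior isClosed_closure.isOpen_compl
    (disjoint_compl_right.mono_left (interior_subset.trans subset_closure)) hcover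
    ?_).trans interior_subset
  exact hne.imp fun x hx => ⟨hx.1, hint x hx.1 (subset_closure hx.2)⟩

theorem ball_subset_of_notMem_thickening_frontier {V : Type*} [SeminormedAddCommGroup V]
    [NormedSpace ℝ V] {F : Set V} {x : V} {r : ℝ}
    (hx : x ∉ Metric.thickening r (frontier F)) (hne : (Metric.ball x r ∩ F).Nonempty) :
    Metric.ball x r ⊆ F := by
  refine subset_of_isPreconnected_of_disjoint_frontier (convex_ball x r).isPreconnected
    (disjoint_left.2 fun u hu hu_frontier => hx ?_) hne
  exact Metric.mem_thickening_iff.2 ⟨u, hu_frontier, Metric.mem_ball'.1 hu⟩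

variable {d : ℕ}

namespace IsometricExchange

variable (E : IsometricExchange d)

/-- The `r`-neighbourhood of the boundaries of the pieces. -/
def boundaryNhd (r : ℝ) : Set (EuclideanSpace ℝ (Fin d)) :=
  ⋃ i, Metric.thickening r (frontier (E.piece i))

theorem isOpen_boundaryNhd (r : ℝ) : IsOpen (E.boundaryNhd r) :=
  isOpen_iUnion fun _ => Metric.isOpen_thickening

variable {E}

theorem exists_eqOn_ball {x : EuclideanSpace ℝ (Fin d)} {r : ℝ} (hr : 0 < r)
    (hx : x ∈ closure E.domain) (hx_boundary : x ∉ E.boundaryNhd r) :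
    ∃ i, EqOn E.map (E.isom i) (Metric.ball x r) := by
  have hx_frontier : ∀ i, x ∉ Metric.thickening r (frontier (E.piece i)) := fun i hi =>
    hx_boundary (mem_iUnion.2 ⟨i, hi⟩)
  rw [domain, closure_iUnion_of_finite, mem_iUnion] at hx
  obtain ⟨i, hxi⟩ := hx
  have hball : Metric.ball x r ⊆ E.piece i :=
    ball_subset_of_notMem_thickening_frontier (hx_frontier i)
      (mem_closure_iff.1 hxi _ Metric.isOpen_ball (Metric.mem_ball_self hr))
  refine ⟨i, fun y hy => ?_⟩
  have hy_piece : ∃ j, y ∈ E.piece j := ⟨i, hball hy⟩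
  have hchoice : hy_piece.choose = i := by
    by_contra hne
    have hball' : Metric.ball x r ⊆ E.piece hy_piece.choose :=
      ball_subset_of_notMem_thickening_frontier (hx_frontier _) ⟨y, hy, hy_piece.choose_spec⟩
    exact (Metric.measure_ball_pos volume x hr).ne'
      (measure_mono_null (subset_inter hball' hball) (E.piece_disjoint _ _ hne))
  rw [map, dif_pos hy_piece, hchoice]

variable (E)

/-- The points at which `g` coincides with the exchange, and that are at distance at least `r`
from the boundaries of the pieces. The map `g` is a measurable version of `E.map`, which need not
be measurable itself. -/
def regularSet (g : EuclideanSpace ℝ (Fin d) → EuclideanSpace ℝ (Fin d)) (r : ℝ) :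
    Set (EuclideanSpace ℝ (Fin d)) :=
  {y | y ∈ closure E.domain ∧ y ∉ E.boundaryNhd r ∧ g y = E.map y}

variable {E} {g : EuclideanSpace ℝ (Fin d) → EuclideanSpace ℝ (Fin d)}

theorem dist_map_eq_of_mem_regularSet {x y : EuclideanSpace ℝ (Fin d)} {r : ℝ}
    (hx : x ∈ E.regularSet g r) (hy : y ∈ E.regularSet g r) (hxy : dist x y < r) :
    dist (g x) (g y) = dist x y := by
  have hr : 0 < r := dist_nonneg.trans_lt hxy
  obtain ⟨i, hi⟩ := exists_eqOn_ball hr hx.1 hx.2.1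
  rw [hx.2.2, hy.2.2, hi (Metric.mem_ball_self hr), hi (Metric.mem_ball'.2 hxy),
    (E.isom i).dist_eq]

theorem dist_iterate_eq_of_mem_regularSet {x y : EuclideanSpace ℝ (Fin d)} {r : ℝ} {n : ℕ}
    (hx : ∀ k < n, g^[k] x ∈ E.regularSet g r) (hy : ∀ k < n, g^[k] y ∈ E.regularSet g r)
    (hxy : dist x y < r) : ∀ k ≤ n, dist (g^[k] x) (g^[k] y) = dist x y := by
  intro k hk
  induction k with
  | zero => rfl
  | succ k ih =>
    have hdist := ih (Nat.le_of_succ_le hk)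
    rw [Function.iterate_succ_apply', Function.iterate_succ_apply',
      dist_map_eq_of_mem_regularSet (hx k hk) (hy k hk) (hdist.trans_lt hxy), hdist]

variable (E)

theorem measure_le (t : Set (EuclideanSpace ℝ (Fin d))) :
    E.measure t ≤ (volume E.domain)⁻¹ * volume t := by
  rw [measure, ProbabilityTheory.cond, Measure.smul_apply, smul_eq_mul]
  gcongr
  exact Measure.restrict_le_self

theorem ae_mem_closure_domain : ∀ᵐ y ∂E.measure, y ∈ closure E.domain := by
  have hcompl : MeasurableSet (closure E.domain)ᶜ := isClosed_closure.measurableSet.compl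
  change E.measure (closure E.domain)ᶜ = 0
  rw [measure, ProbabilityTheory.cond_apply' hcompl,
    (disjoint_compl_right.mono_left subset_closure).inter_eq, measure_empty, mul_zero]

variable {E}

theorem isProbabilityMeasure_measure (hE : Bornology.IsBounded E.domain) :
    IsProbabilityMeasure E.measure :=
  ProbabilityTheory.cond_isProbabilityMeasure_of_finite E.volume_ne_zero hE.measure_lt_top.ne

theorem compl_regularSet_ae_eq (hg : g =ᵐ[E.measure] E.map) (r : ℝ) :
    ((E.regularSet g r)ᶜ : Set (EuclideanSpace ℝ (Fin d))) =ᵐ[E.measure] E.boundaryNhd r := by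
  filter_upwards [hg, E.ae_mem_closure_domain] with y hy hy_domain
  refine propext ⟨fun h => ?_, fun h h' => h'.2.1 h⟩
  by_contra hy_boundary
  exact h ⟨hy_domain, hy_boundary, hy⟩

end IsometricExchange

end LocalIsometry

/-! ### Grid codes -/

section Grid

variable {d : ℕ}

/-- The cell containing `x` of the cubic grid with mesh `1 / K`. -/
def gridCode (K : ℕ) (x : EuclideanSpace ℝ (Fin d)) : Fin d → ℤ := fun i => ⌊x i * K⌋

theorem gridCode_mem_Icc {K R : ℕ} {x : EuclideanSpace ℝ (Fin d)} (hx : ‖x‖ ≤ R) :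
    gridCode K x ∈ Finset.Icc (-((R * K : ℕ) : Fin d → ℤ)) (R * K : ℕ) := by
  have hcoord : ∀ i, |x i * K| ≤ (R * K : ℕ) := fun i => by
    rw [abs_mul, Nat.abs_cast, Nat.cast_mul]
    exact mul_le_mul_of_nonneg_right ((PiLp.norm_apply_le x i).trans hx) K.cast_nonneg
  refine Finset.mem_Icc.2 ⟨fun i => Int.le_floor.2 ?_, fun i => ?_⟩
  · simpa using (abs_le.1 (hcoord i)).1
  · exact Int.cast_le (R := ℝ).1 ((Int.floor_le _).trans (by simpa using (abs_le.1 (hcoord i)).2))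

theorem card_Icc_neg_natCast (M : ℕ) :
    (Finset.Icc (-(M : Fin d → ℤ)) M).card = (2 * M + 1) ^ d := by
  rw [Pi.card_Icc]
  simp only [Pi.neg_apply, Pi.natCast_apply, Int.card_Icc, Finset.prod_const, Finset.card_univ,
    Fintype.card_fin]
  congr 1
  omega

theorem dist_lt_of_gridCode_eq {K : ℕ} {r : ℝ} (hK : d < r * K)
    {x y : EuclideanSpace ℝ (Fin d)} (h : gridCode K x = gridCode K y) : dist x y < r := by
  have hd : (0 : ℝ) ≤ d := d.cast_nonneg
  have hK_pos : (0 : ℝ) < K := K.cast_nonneg.lt_of_ne' fun hK_zero => by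
    rw [hK_zero, mul_zero] at hK
    exact hd.not_gt hK
  have hr : 0 < r := pos_of_mul_pos_left (hd.trans_lt hK) hK_pos.le
  have hcoord : ∀ i, dist (x i) (y i) ≤ 1 / K := fun i => by
    have hfloor := Int.abs_sub_lt_one_of_floor_eq_floor (congrFun h i)
    rw [← sub_mul, abs_mul, Nat.abs_cast, ← lt_div_iff₀ hK_pos] at hfloor
    exact hfloor.le
  rw [EuclideanSpace.dist_eq, Real.sqrt_lt' hr]
  calc ∑ i, dist (x i) (y i) ^ 2 ≤ ∑ _ : Fin d, (1 / K : ℝ) ^ 2 := by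
        gcongr with i
        exact hcoord i
    _ = d * (1 / K : ℝ) ^ 2 := by simp
    _ ≤ d ^ 2 * (1 / K : ℝ) ^ 2 := by
        gcongr
        exact_mod_cast Nat.le_self_pow two_ne_zero d
    _ = (d / K) ^ 2 := by ring
    _ < r ^ 2 := by
        gcongr
        exact (div_lt_iff₀ hK_pos).2 hK

theorem eventually_polynomial_pow_le_two_pow (c p d : ℕ) :
    ∀ᶠ m : ℕ in atTop, (2 * (c * m ^ p) + 1) ^ d ≤ 2 ^ m := by
  have hlim := (tendsto_pow_const_div_const_pow_of_one_lt (p * d) (r := 2) one_lt_two).const_mul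
    (((2 * c + 1) ^ d : ℕ) : ℝ)
  rw [mul_zero] at hlim
  filter_upwards [hlim.eventually (gt_mem_nhds one_pos), eventually_ge_atTop 1] with m hm hm_one
  rw [← mul_div_assoc, div_lt_one (by positivity)] at hm
  calc (2 * (c * m ^ p) + 1) ^ d ≤ ((2 * c + 1) * m ^ p) ^ d := by
        gcongr
        linarith [Nat.one_le_pow p m hm_one]
    _ = (2 * c + 1) ^ d * m ^ (p * d) := by rw [mul_pow, pow_mul]
    _ ≤ 2 ^ m := by exact_mod_cast hm.le

end Grid

/-! ### Figure exchanges have few itineraries -/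

section FigureExchange

open scoped Topology

variable {d : ℕ}

theorem sq_mul_rpow_le {C s : ℝ} {p m : ℕ} (hp : 3 ≤ p * s) (hm : 1 ≤ m) :
    (m : ℝ) ^ 2 * (C * (1 / (m : ℝ) ^ p) ^ s) ≤ |C| * (1 / m) := by
  have hm_one : (1 : ℝ) ≤ m := by exact_mod_cast hm
  have hm_pos : (0 : ℝ) < m := one_pos.trans_le hm_one
  have hrpow : (1 / (m : ℝ) ^ p) ^ s ≤ (1 / (m : ℝ)) ^ 3 := by
    rw [← one_div_pow, ← Real.rpow_natCast, ← Real.rpow_mul (by positivity), ← Real.rpow_natCast]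
    exact Real.rpow_le_rpow_of_exponent_ge (by positivity) ((div_le_one hm_pos).2 hm_one)
      (by exact_mod_cast hp)
  calc (m : ℝ) ^ 2 * (C * (1 / (m : ℝ) ^ p) ^ s) ≤ (m : ℝ) ^ 2 * (|C| * (1 / (m : ℝ)) ^ 3) := by
        gcongr
        exact le_abs_self C
    _ = |C| * (1 / m) := by field_simp

theorem IsFigure.eventually_tendsto_sq_mul_volume_thickening
    {F : Set (EuclideanSpace ℝ (Fin d))} (hF : IsFigure F) :
    ∀ᶠ p : ℕ in atTop, Tendsto (fun m : ℕ => (m : ENNReal) ^ 2 *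
      volume (Metric.thickening (1 / (m : ℝ) ^ p) (frontier F))) atTop (𝓝 0) := by
  obtain ⟨-, C, s, hs, hC⟩ := hF
  filter_upwards [tendsto_natCast_atTop_atTop.eventually_ge_atTop (3 / s)] with p hp
  rw [div_le_iff₀ hs] at hp
  have hlim : Tendsto (fun m : ℕ => ENNReal.ofReal (|C| * (1 / m))) atTop (𝓝 0) := by
    simpa using ENNReal.tendsto_ofReal
      ((tendsto_one_div_atTop_nhds_zero_nat (𝕜 := ℝ)).const_mul |C|)
  refine tendsto_of_tendsto_of_tendsto_of_le_of_le' tendsto_const_nhds hlim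
    (Eventually.of_forall fun _ => zero_le) ?_
  filter_upwards [eventually_ge_atTop 1] with m hm
  have hm_pow : (1 : ℝ) ≤ (m : ℝ) ^ p := one_le_pow₀ (by exact_mod_cast hm)
  calc (m : ENNReal) ^ 2 * volume (Metric.thickening (1 / (m : ℝ) ^ p) (frontier F))
      ≤ m ^ 2 * ENNReal.ofReal (C * (1 / (m : ℝ) ^ p) ^ s) := by
        gcongr
        exact hC _ (by positivity) ((div_le_one (by positivity)).2 hm_pow)
    _ = ENNReal.ofReal ((m : ℝ) ^ 2 * (C * (1 / (m : ℝ) ^ p) ^ s)) := by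
        rw [ENNReal.ofReal_mul (p := (m : ℝ) ^ 2) (by positivity),
          ENNReal.ofReal_pow m.cast_nonneg, ENNReal.ofReal_natCast]
    _ ≤ ENNReal.ofReal (|C| * (1 / m)) := ENNReal.ofReal_le_ofReal (sq_mul_rpow_le hp hm)

namespace IsometricExchange

variable {E : IsometricExchange d}

theorem IsFigureExchange.isBounded_domain (hE : E.IsFigureExchange) :
    Bornology.IsBounded E.domain :=
  Bornology.isBounded_iUnion.2 fun i => (hE i).1

theorem IsFigureExchange.exists_tendsto_sq_mul_measure_boundaryNhd (hE : E.IsFigureExchange) :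
    ∃ p : ℕ, p ≠ 0 ∧ Tendsto (fun m : ℕ => (m : ℝ) ^ 2 *
      E.measure.real (E.boundaryNhd (1 / (m : ℝ) ^ p))) atTop (𝓝 0) := by
  obtain ⟨p, hp_zero, hp⟩ := ((eventually_ne_atTop 0).and (eventually_all.2 fun i =>
    (hE i).eventually_tendsto_sq_mul_volume_thickening)).exists
  refine ⟨p, hp_zero, ?_⟩
  have hlim : Tendsto (fun m : ℕ => (volume E.domain)⁻¹ * ∑ i, (m : ENNReal) ^ 2 *
      volume (Metric.thickening (1 / (m : ℝ) ^ p) (frontier (E.piece i)))) atTop (𝓝 0) := by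
    have hvolume : (volume E.domain)⁻¹ ≠ ⊤ := ENNReal.inv_ne_top.2 E.volume_ne_zero
    simpa using ENNReal.Tendsto.const_mul (tendsto_finsetSum Finset.univ fun i _ => hp i)
      (.inr hvolume)
  have hmeasure : Tendsto (fun m : ℕ => (m : ENNReal) ^ 2 *
      E.measure (E.boundaryNhd (1 / (m : ℝ) ^ p))) atTop (𝓝 0) := by
    refine tendsto_of_tendsto_of_tendsto_of_le_of_le tendsto_const_nhds hlim
      (fun _ => zero_le) fun m => ?_
    rw [← Finset.mul_sum, mul_left_comm]
    gcongr
    refine (E.measure_le _).trans ?_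
    gcongr
    exact measure_iUnion_fintype_le _ _
  simpa [measureReal_def, Function.comp_def] using
    (ENNReal.tendsto_toReal ENNReal.zero_ne_top).comp hmeasure

variable {g : EuclideanSpace ℝ (Fin d) → EuclideanSpace ℝ (Fin d)}
  {B Z : Set (EuclideanSpace ℝ (Fin d))}

/-- The points whose orbit up to time `n` stays in `E.regularSet g r` and visits `Z` with
frequency at most `1 / 16`. -/
def typicalSet (E : IsometricExchange d)
    (g : EuclideanSpace ℝ (Fin d) → EuclideanSpace ℝ (Fin d))
    (Z : Set (EuclideanSpace ℝ (Fin d))) (r : ℝ) (n : ℕ) : Set (EuclideanSpace ℝ (Fin d)) :=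
  {y | (∀ k < n, g^[k] y ∈ E.regularSet g r) ∧ 16 * visits g Z n y ≤ n}

theorem measureReal_compl_typicalSet_le [IsFiniteMeasure E.measure]
    (hg : MeasurePreserving g E.measure E.measure) (hgE : g =ᵐ[E.measure] E.map)
    (hZ : MeasurableSet Z) (r : ℝ) (n : ℕ) :
    E.measure.real (E.typicalSet g Z r n)ᶜ ≤
      n * E.measure.real (E.boundaryNhd r) + 16 * E.measure.real Z := by
  have hae := compl_regularSet_ae_eq hgE r
  have hnull : NullMeasurableSet (E.regularSet g r)ᶜ E.measure :=
    (E.isOpen_boundaryNhd r).measurableSet.nullMeasurableSet.congr hae.symm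
  have hsub : (E.typicalSet g Z r n)ᶜ ⊆
      {y | ∃ k < n, g^[k] y ∈ (E.regularSet g r)ᶜ} ∪ {y | n < 16 * visits g Z n y} := by
    intro y hy
    by_contra! h
    simp only [mem_union, mem_ofPred_eq, mem_compl_iff, not_or, not_exists, not_and, not_not,
      not_lt] at h
    exact hy h
  rw [← measureReal_congr hae]
  exact (measureReal_mono hsub).trans ((measureReal_union_le _ _).trans
    (add_le_add (measureReal_exists_iterate_mem_le hg hnull n)
      (by exact_mod_cast measureReal_lt_mul_visits_le hg hZ n 16)))

theorem mismatch_le_of_mem_typicalSet {x y : EuclideanSpace ℝ (Fin d)} {r δ : ℝ} {n : ℕ}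
    (hsep : ∀ x ∉ Z, ∀ y ∉ Z, dist x y < δ → (x ∈ B ↔ y ∈ B)) (hrδ : r ≤ δ)
    (hx : x ∈ E.typicalSet g Z r n) (hy : y ∈ E.typicalSet g Z r n) (hxy : dist x y < r) :
    8 * mismatch g B (itinerary g B n y) x ≤ n := by
  have hmismatch : mismatch g B (itinerary g B n y) x ≤ visits g Z n x + visits g Z n y := by
    refine mismatch_itinerary_le_visits_add_visits fun k hk hxZ hyZ => hsep _ hxZ _ hyZ ?_
    rw [dist_iterate_eq_of_mem_regularSet hx.1 hy.1 hxy k hk.le]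
    exact hxy.trans_le hrδ
  have hx_visits := hx.2
  have hy_visits := hy.2
  omega

theorem not_isComplexAt_of_boundaryNhd_lt [IsProbabilityMeasure E.measure]
    (hg : MeasurePreserving g E.measure E.measure) (hgE : g =ᵐ[E.measure] E.map)
    (hZ : MeasurableSet Z) (hZ_le : E.measure.real Z ≤ 1 / 64) {δ : ℝ}
    (hsep : ∀ x ∉ Z, ∀ y ∉ Z, dist x y < δ → (x ∈ B ↔ y ∈ B))
    {R : ℕ} (hR : ∀ y ∈ closure E.domain, ‖y‖ ≤ R) {m K : ℕ} (hm : m ≠ 0) {r : ℝ} (hrδ : r ≤ δ)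
    (hK : d < r * K) (hcard : (2 * (R * K) + 1) ^ d ≤ 2 ^ m)
    (hboundary : (m : ℝ) ^ 2 * E.measure.real (E.boundaryNhd r) < 1 / 4) :
    ¬ IsComplexAt E.measure g B m := by
  refine not_isComplexAt_of_code (G := E.typicalSet g Z r (m ^ 2)) ?_ (gridCode K)
    (c := Finset.Icc (-((R * K : ℕ) : Fin d → ℤ)) (R * K : ℕ)) ?_ (fun x hx => ?_)
    fun x hx y hy hxy => mismatch_le_of_mem_typicalSet hsep hrδ hx hy
      (dist_lt_of_gridCode_eq hK hxy)
  · have hle := measureReal_compl_typicalSet_le hg hgE hZ r (m ^ 2)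
    push_cast at hle
    linarith
  · rwa [card_Icc_neg_natCast]
  · exact gridCode_mem_Icc (hR _ (hx.1 0 (by positivity)).1)

theorem IsFigureExchange.eventually_not_isComplexAt (hE : E.IsFigureExchange)
    (hg : MeasurePreserving g E.measure E.measure) (hgE : g =ᵐ[E.measure] E.map)
    (hB : MeasurableSet B) : ∀ᶠ m in atTop, ¬ IsComplexAt E.measure g B m := by
  have hprob := isProbabilityMeasure_measure hE.isBounded_domain
  obtain ⟨p, hp, hboundary⟩ := hE.exists_tendsto_sq_mul_measure_boundaryNhd
  obtain ⟨R₀, hR₀⟩ := hE.isBounded_domain.closure.exists_norm_le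
  obtain ⟨R, hR⟩ := exists_nat_ge R₀
  obtain ⟨Z, hZ, hZ_le, δ, hδ, hsep⟩ := exists_measureReal_le_separated (ν := E.measure) hB
    (ε := 1 / 64) (by norm_num)
  have hscale : Tendsto (fun m : ℕ => 1 / (m : ℝ) ^ p) atTop (𝓝 0) := by
    simpa [hp] using (tendsto_one_div_atTop_nhds_zero_nat (𝕜 := ℝ)).pow p
  filter_upwards [hboundary.eventually (gt_mem_nhds (by norm_num : (0 : ℝ) < 1 / 4)),
    hscale.eventually (gt_mem_nhds hδ), eventually_polynomial_pow_le_two_pow (R * (d + 1)) p d,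
    eventually_ne_atTop 0] with m hm_boundary hm_scale hm_card hm
  have hgrid : (d : ℝ) < 1 / (m : ℝ) ^ p * ((d + 1) * m ^ p : ℕ) := by
    push_cast
    field_simp
    linarith
  exact not_isComplexAt_of_boundaryNhd_lt hg hgE hZ hZ_le hsep
    (fun y hy => (hR₀ y hy).trans hR) hm hm_scale.le hgrid (by rwa [← mul_assoc R]) hm_boundary

theorem IsFigureExchange.eventually_not_isComplexAt_of_isIsomorphic {X : Type*}
    [MeasurableSpace X] {μ : Measure X} {T : X → X} (hE : E.IsFigureExchange)
    (hT : MeasurePreserving T μ μ) (hiso : IsIsomorphic μ T E.measure E.map) {B : Set X}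
    (hB : MeasurableSet B) : ∀ᶠ m in atTop, ¬ IsComplexAt μ T B m := by
  obtain ⟨φ, ψ, hφ, hψ, hψφ, hφψ, hint⟩ := hiso
  have hg : MeasurePreserving (φ ∘ T ∘ ψ) E.measure E.measure := hφ.comp (hT.comp hψ)
  have hgE : φ ∘ T ∘ ψ =ᵐ[E.measure] E.map := by
    filter_upwards [hψ.quasiMeasurePreserving.ae hint, hφψ] with y hy hφψy
    exact hy.trans (congrArg E.map hφψy)
  have hsemiconj : ∀ᵐ y ∂E.measure, ψ ((φ ∘ T ∘ ψ) y) = T (ψ y) :=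
    (hT.comp hψ).quasiMeasurePreserving.ae hψφ
  filter_upwards [hE.eventually_not_isComplexAt hg hgE (hψ.measurable hB)] with m hm
  rwa [← isComplexAt_preimage_iff hg.quasiMeasurePreserving hT.measurable hψ hsemiconj hB]

end IsometricExchange

end FigureExchange

/-! ### Rectangles are figures -/

section Rectangle

theorem measurePreserving_isometryEquiv {d : ℕ}
    (g : EuclideanSpace ℝ (Fin d) ≃ᵢ EuclideanSpace ℝ (Fin d)) :
    MeasurePreserving g volume volume := by
  simpa only [EuclideanSpace.euclideanHausdorffMeasure_eq_volume] using
    g.measurePreserving_euclideanHausdorffMeasure d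

variable {ι : Type*} {a b : ι → ℝ}

/-- The open rectangle with sides parallel to the coordinate axes and opposite corners
`a` and `b`. -/
def openBox (a b : ι → ℝ) : Set (EuclideanSpace ℝ ι) := {x | ∀ k, a k < x k ∧ x k < b k}

/-- The closed rectangle with sides parallel to the coordinate axes and opposite corners
`a` and `b`. -/
def closedBox (a b : ι → ℝ) : Set (EuclideanSpace ℝ ι) := {x | ∀ k, a k ≤ x k ∧ x k ≤ b k}

/-- The part of the unit enlargement of `closedBox a b` within distance `r` of the hyperplane
`x k = c`. -/
def slab [DecidableEq ι] (a b : ι → ℝ) (k : ι) (c r : ℝ) : Set (EuclideanSpace ℝ ι) :=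
  closedBox (Function.update (fun j => a j - 1) k (c - r))
    (Function.update (fun j => b j + 1) k (c + r))

theorem closedBox_eq_preimage (a b : ι → ℝ) : closedBox a b = WithLp.ofLp ⁻¹' Icc a b :=
  ext fun _ => forall_and

theorem isClosed_closedBox (a b : ι → ℝ) : IsClosed (closedBox a b) := by
  rw [closedBox_eq_preimage]
  exact isClosed_Icc.preimage (PiLp.continuous_ofLp 2 _)

theorem mem_slab [DecidableEq ι] {k : ι} {c r : ℝ} {x : EuclideanSpace ℝ ι}
    (hx : ∀ j, a j - 1 ≤ x j ∧ x j ≤ b j + 1) (hk : |x k - c| ≤ r) : x ∈ slab a b k c r := by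
  intro j
  obtain rfl | hj := eq_or_ne j k
  · obtain ⟨hk_lower, hk_upper⟩ := abs_le.1 hk
    simp only [Function.update_self]
    constructor <;> linarith
  · simpa only [Function.update_of_ne hj] using hx j

theorem isOpen_openBox [Finite ι] (a b : ι → ℝ) : IsOpen (openBox a b) := by
  have hpi : openBox a b = WithLp.ofLp ⁻¹' univ.pi fun k => Ioo (a k) (b k) := by
    ext x
    simp [openBox]
  rw [hpi]
  exact (isOpen_set_pi (toFinite univ) fun _ _ => isOpen_Ioo).preimage (PiLp.continuous_ofLp 2 _)

theorem isBounded_closedBox [Finite ι] (a b : ι → ℝ) : Bornology.IsBounded (closedBox a b) := by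
  cases nonempty_fintype ι
  rw [closedBox_eq_preimage]
  exact (PiLp.antilipschitzWith_ofLp 2 fun _ : ι => ℝ).isBounded_preimage (Metric.isBounded_Icc a b)

variable [Fintype ι]

theorem volume_closedBox (a b : ι → ℝ) :
    volume (closedBox a b) = ∏ j, ENNReal.ofReal (b j - a j) := by
  rw [closedBox_eq_preimage, (PiLp.volume_preserving_ofLp ι).measure_preimage
    measurableSet_Icc.nullMeasurableSet, Real.volume_Icc_pi]

theorem prod_side_add_two_nonneg (hab : ∀ k, a k < b k) : 0 ≤ ∏ j, (b j - a j + 2) :=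
  Finset.prod_nonneg fun j _ => by linarith [hab j]

theorem volume_slab_le [DecidableEq ι] (hab : ∀ k, a k < b k) (k : ι) (c : ℝ) {r : ℝ}
    (hr : 0 ≤ r) :
    volume (slab a b k c r) ≤ ENNReal.ofReal ((∏ j, (b j - a j + 2)) * (2 * r)) := by
  have hside : ∀ j, Function.update (fun j => b j + 1) k (c + r) j -
      Function.update (fun j => a j - 1) k (c - r) j ≤
        (b j - a j + 2) * if j = k then 2 * r else 1 := by
    intro j
    obtain rfl | hj := eq_or_ne j k
    · simp only [Function.update_self, if_true]
      nlinarith [hab j]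
    · simp only [Function.update_of_ne hj, if_neg hj]
      linarith
  have hnonneg : ∀ j, 0 ≤ (b j - a j + 2) * if j = k then 2 * r else 1 := fun j =>
    mul_nonneg (by linarith [hab j]) (by split_ifs <;> positivity)
  calc volume (slab a b k c r)
      ≤ ∏ j, ENNReal.ofReal ((b j - a j + 2) * if j = k then 2 * r else 1) := by
        rw [slab, volume_closedBox]
        exact Finset.prod_le_prod' fun j _ => ENNReal.ofReal_le_ofReal (hside j)
    _ = ENNReal.ofReal ((∏ j, (b j - a j + 2)) * (2 * r)) := by
        rw [← ENNReal.ofReal_prod_of_nonneg fun j _ => hnonneg j, Finset.prod_mul_distrib,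
          Fintype.prod_ite_eq']

theorem thickening_closedBox_sdiff_openBox_subset [DecidableEq ι] {r : ℝ} (hr : r ≤ 1) :
    Metric.thickening r (closedBox a b \ openBox a b) ⊆
      ⋃ k, (slab a b k (a k) r ∪ slab a b k (b k) r) := by
  intro x hx
  obtain ⟨u, ⟨hu_closed, hu_open⟩, hxu⟩ := Metric.mem_thickening_iff.1 hx
  have hcoord : ∀ j, |x j - u j| ≤ r := fun j =>
    (PiLp.norm_apply_le (x - u) j).trans (dist_eq_norm x u ▸ hxu.le)
  have hbox : ∀ j, a j - 1 ≤ x j ∧ x j ≤ b j + 1 := fun j => by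
    obtain ⟨hj_lower, hj_upper⟩ := abs_le.1 (hcoord j)
    obtain ⟨hu_lower, hu_upper⟩ := hu_closed j
    constructor <;> linarith
  obtain ⟨k, hk⟩ : ∃ k, ¬(a k < u k ∧ u k < b k) := not_forall.1 hu_open
  refine mem_iUnion.2 ⟨k, ?_⟩
  rcases (hu_closed k).1.eq_or_lt with hak | hak
  · exact .inl (mem_slab hbox (hak ▸ hcoord k))
  · have hbk : u k = b k := (hu_closed k).2.antisymm (not_lt.1 fun h => hk ⟨hak, h⟩)
    exact .inr (mem_slab hbox (hbk ▸ hcoord k))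

theorem volume_thickening_closedBox_sdiff_openBox_le (hab : ∀ k, a k < b k) {r : ℝ}
    (hr : 0 ≤ r) (hr_one : r ≤ 1) :
    volume (Metric.thickening r (closedBox a b \ openBox a b)) ≤
      ENNReal.ofReal (4 * Fintype.card ι * (∏ j, (b j - a j + 2)) * r) := by
  classical
  have hprod := prod_side_add_two_nonneg hab
  calc volume (Metric.thickening r (closedBox a b \ openBox a b))
      ≤ volume (⋃ k, (slab a b k (a k) r ∪ slab a b k (b k) r)) :=
        measure_mono (thickening_closedBox_sdiff_openBox_subset hr_one)
    _ ≤ ∑ _ : ι, (ENNReal.ofReal ((∏ j, (b j - a j + 2)) * (2 * r)) +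
          ENNReal.ofReal ((∏ j, (b j - a j + 2)) * (2 * r))) :=
        (measure_iUnion_fintype_le _ _).trans (Finset.sum_le_sum fun k _ =>
          (measure_union_le _ _).trans
            (add_le_add (volume_slab_le hab k _ hr) (volume_slab_le hab k _ hr)))
    _ = ENNReal.ofReal (4 * Fintype.card ι * (∏ j, (b j - a j + 2)) * r) := by
        rw [← ENNReal.ofReal_add (by positivity) (by positivity), Finset.sum_const,
          Finset.card_univ, nsmul_eq_mul, ← ENNReal.ofReal_natCast,
          ← ENNReal.ofReal_mul (Nat.cast_nonneg _)]
        ring_nf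

theorem frontier_subset_sdiff {Y : Type*} [TopologicalSpace Y] {F U Q : Set Y} (hU : IsOpen U)
    (hQ : IsClosed Q) (hUF : U ⊆ F) (hFQ : F ⊆ Q) : frontier F ⊆ Q \ U :=
  sdiff_subset_sdiff (closure_minimal hFQ hQ) (interior_maximal hUF hU)

theorem thickening_image_isometryEquiv {Y Z : Type*} [PseudoMetricSpace Y] [PseudoMetricSpace Z]
    (g : Y ≃ᵢ Z) (r : ℝ) (S : Set Y) :
    Metric.thickening r (g '' S) = g.symm ⁻¹' Metric.thickening r S := by
  ext z
  simp only [Metric.mem_thickening_iff, exists_mem_image, mem_preimage]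
  refine exists_congr fun y => and_congr_right fun _ => ?_
  rw [← g.symm.dist_eq z, g.symm_apply_apply]

theorem IsRectangle.isFigure {d : ℕ} {F : Set (EuclideanSpace ℝ (Fin d))} (hF : IsRectangle F) :
    IsFigure F := by
  obtain ⟨a, b, g, hab, hUF, hFQ⟩ := hF
  change g '' openBox a b ⊆ F at hUF
  change F ⊆ g '' closedBox a b at hFQ
  have hfrontier : frontier F ⊆ g '' (closedBox a b \ openBox a b) := by
    rw [image_sdiff g.injective]
    exact frontier_subset_sdiff (g.toHomeomorph.isOpenMap _ (isOpen_openBox a b))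
      (g.toHomeomorph.isClosedMap _ (isClosed_closedBox a b)) hUF hFQ
  refine ⟨(g.isometry.lipschitz.isBounded_image (isBounded_closedBox a b)).subset hFQ,
    4 * Fintype.card (Fin d) * ∏ j, (b j - a j + 2), 1, one_pos, fun r hr hr_one => ?_⟩
  calc volume (Metric.thickening r (frontier F))
      ≤ volume (Metric.thickening r (g '' (closedBox a b \ openBox a b))) :=
        measure_mono (Metric.thickening_subset_of_subset r hfrontier)
    _ = volume (Metric.thickening r (closedBox a b \ openBox a b)) := by
        rw [thickening_image_isometryEquiv]
        exact (measurePreserving_isometryEquiv g.symm).measure_preimage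
          Metric.isOpen_thickening.measurableSet.nullMeasurableSet
    _ ≤ _ := by
        rw [Real.rpow_one]
        exact volume_thickening_closedBox_sdiff_openBox_le hab hr.le hr_one

end Rectangle

end GenericExchange

end

theorem mainTheorem3 {X : Type*} [MeasurableSpace X] [StandardBorelSpace X]
    (μ : MeasureTheory.Measure X) [MeasureTheory.IsProbabilityMeasure μ]
    [MeasureTheory.NullSingletonClass μ]
    (A : ℕ → Set X) (hA : GenericExchange.IsDenseFamily μ A) :
    GenericExchange.IsGenericProperty μ A
      (fun T => ∀ (d : ℕ) (E : GenericExchange.IsometricExchange d),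
        E.IsFigureExchange → ¬ T.IsomorphicToExchange E) ∧
    GenericExchange.IsGenericProperty μ A
      (fun T => ∀ (d : ℕ) (E : GenericExchange.IsometricExchange d),
        E.IsRectangleExchange → ¬ T.IsomorphicToExchange E) := by
  obtain ⟨B, hB, hB_half⟩ := GenericExchange.exists_measure_eq_half μ
  obtain ⟨W, hW, hW_dense, hW_complex⟩ :=
    GenericExchange.isGenericProperty_frequently_mem_complexSet hA hB hB_half
  have not_figureExchange : ∀ T ∈ W, ∀ (d : ℕ) (E : GenericExchange.IsometricExchange d),
      E.IsFigureExchange → ¬ T.IsomorphicToExchange E := by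
    rintro T hT d E hE ⟨S, hS, hiso⟩
    obtain ⟨m, hm_complex, hm⟩ := ((hW_complex T hT).and_eventually
      (hE.eventually_not_isComplexAt_of_isIsomorphic S.2 hiso hB)).exists
    exact hm (hm_complex S hS)
  exact ⟨⟨W, hW, hW_dense, not_figureExchange⟩, ⟨W, hW, hW_dense, fun T hT d E hE =>
    not_figureExchange T hT d E fun i => (hE i).isFigure⟩⟩
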